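/- Let $\Bbbk$ be a field and let $(\mathcal V,\mathcal H)$ be a matched pair of finite groupoids with the same base $\mathcal P$. Here arrows are composed from left to right, $t,b$ denote the source and end maps of $\mathcal V$ and $l,r$ the source and end maps of $\mathcal H$; the matched pair consists of a left action $(x,g)\mapsto x\triangleright g\in\mathcal V$ of $\mathcal H$ on $t$ and a right action $(x,g)\mapsto x\triangleleft g\in\mathcal H$ of $\mathcal V$ on $r$, both defined for $x\in\mathcal H$, $g\in\mathcal V$ with $r(x)=t(g)$, such that $$b(x\triangleright g)=l(x\triangleleft g),\qquad x\triangleright fg=(x\triangleright f)\bigl((x\triangleleft f)\triangleright g\bigr),\qquad xy\triangleleft g=\bigl(x\triangleleft(y\triangleright g)\bigr)(y\triangleleft g)$$ whenever these expressions are defined. The weak Hopf algebra $\Bbbk(\mathcal V,\mathcal H)$ is the $\Bbbk$-vector space whose basis is the set of cells $(x,g)\in\mathcal H\times\mathcal V$ with $r(x)=t(g)$. Its product is $(x,g)(y,f)=(xy,f)$ if $g=y\triangleright f$, and $0$ otherwise; its unit is $\sum_{g\in\mathcal V}(\mathrm{id}_{t(g)},g)$; its coproduct is $\Delta(x,g)=\sum_{g=g_1g_2}(x,g_1)\otimes(x\triangleleft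 g_1,g_2)$; its counit sends $(x,g)$ to $1$ if $g$ is an identity and to $0$ otherwise; its antipode is $S(x,g)=\bigl((x\triangleleft g)^{-1},(x\triangleright g)^{-1}\bigr)$. A rotation for $(\mathcal V,\mathcal H)$ is a morphism of groupoids $\kappa:\mathcal V\to\mathcal H$ that is the identity on $\mathcal P$ and satisfies $y\,\kappa(g)=\kappa(y\triangleright g)\,(y\triangleleft g)$ whenever $r(y)=t(g)$. A matched pair of rotations is a pair $(\xi,\eta)$ of rotations such that, for all $f,g\in\mathcal V$ with $b(g)=t(f)$, $$b\bigl(\eta(g)\triangleright f\bigr)=b\bigl(\xi(f)^{-1}\triangleright g^{-1}\bigr)\qquad\text{and}\qquad \bigl(\eta(g)\triangleright f\bigr)\bigl(\xi(f)^{-1}\triangleright g^{-1}\bigr)^{-1}=gf .$$ Theorem. Let $(\xi,\eta)$ be a matched pair of rotations for $(\mathcal V,\mathcal H)$, let $H=\Bbbk(\mathcal V,\mathcal H)$, and put $$R=\sum_{\substack{f,g\in\mathcal V\\ b(g)=t(f)}}\bigl(\xi(f)^{-1}\triangleleft g^{-1},\,g\bigr)\otimes\bigl(\eta(g),\,f\bigr)\in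 H\otimes_{\Bbbk}H .$$ Then $(H,R)$ is a quasitriangular weak Hopf algebra. That is, $H$ is a weak Hopf algebra with antipode $S$; moreover $R\in\Delta^{\mathrm{cop}}(1)(H\otimes H)\Delta(1)$, $\Delta^{\mathrm{cop}}(h)R=R\Delta(h)$ for all $h\in H$, $(\mathrm{id}\otimes\Delta)(R)=R_{13}R_{12}$, $(\Delta\otimes\mathrm{id})(R)=R_{13}R_{23}$, and there is $\overline R\in\Delta(1)(H\otimes H)\Delta^{\mathrm{cop}}(1)$ with $R\overline R=\Delta^{\mathrm{cop}}(1)$ and $\overline RR=\Delta(1)$. -/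

import Mathlib

open CategoryTheory TensorProduct

namespace MatchedGpd

universe u v w

/-! ### Groupoids through their sets of arrows

Two groupoids `V`, `H` over the same base `P` are two terms of Mathlib's `CategoryTheory.Groupoid P`.
Products are written from left to right: `comp f g` is `f` followed by `g`. -/

/-- The set of all arrows of a groupoid with base `P`. -/
structure Arr {P : Type u} (G : Groupoid.{v} P) where
  src : P
  tgt : P
  hom : src ⟶ tgt

namespace Arr

variable {P : Type u} {G : Groupoid.{v} P}

/-- The product `f g`, defined when the end of `f` is the source of `g`. -/
def comp (f g : Arr G) (h : f.tgt = g.src) : Arr G :=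
  ⟨f.src, g.tgt, f.hom ≫ eqToHom h ≫ g.hom⟩

/-- The identity arrow at `p`. -/
def one (G : Groupoid.{v} P) (p : P) : Arr G := ⟨p, p, 𝟙 p⟩

/-- The inverse arrow. -/
def inv (f : Arr G) : Arr G := ⟨f.tgt, f.src, Groupoid.inv f.hom⟩

@[simp] theorem comp_src (f g : Arr G) (h : f.tgt = g.src) : (f.comp g h).src = f.src := rfl
@[simp] theorem comp_tgt (f g : Arr G) (h : f.tgt = g.src) : (f.comp g h).tgt = g.tgt := rfl
@[simp] theorem one_src (p : P) : (one G p).src = p := rfl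
@[simp] theorem one_tgt (p : P) : (one G p).tgt = p := rfl
@[simp] theorem inv_src (f : Arr G) : f.inv.src = f.tgt := rfl
@[simp] theorem inv_tgt (f : Arr G) : f.inv.tgt = f.src := rfl

theorem assoc (f g k : Arr G) (h : f.tgt = g.src) (h' : g.tgt = k.src) :
    (f.comp g h).comp k h' = f.comp (g.comp k h') h := by
  simp [comp]

theorem one_comp (p : P) (f : Arr G) (h : (one G p).tgt = f.src) : (one G p).comp f h = f := by
  obtain rfl : p = f.src := h
  simp [comp, one]

theorem comp_one (p : P) (f : Arr G) (h : f.tgt = (one G p).src) : f.comp (one G p) h = f := by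
  obtain rfl : f.tgt = p := h
  simp [comp, one]

theorem comp_inv (f : Arr G) : f.comp f.inv rfl = one G f.src := by
  simp [comp, one, inv]

theorem inv_comp (f : Arr G) : f.inv.comp f rfl = one G f.tgt := by
  simp [comp, one, inv]

/-- Cancellation, for products equal to one of the factors. -/
theorem eq_one_of_comp_eq (f g : Arr G) (h : f.tgt = g.src) (e : f.comp g h = f) :
    g = one G g.src := by
  obtain ⟨p, q, a⟩ := f
  obtain ⟨q', r, c⟩ := g
  obtain rfl : q = q' := h
  simp only [comp, eqToHom_refl, Category.id_comp, Arr.mk.injEq, true_and] at e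
  obtain ⟨rfl, hm⟩ := e
  have hc : c = 𝟙 _ := (cancel_epi a).1 ((eq_of_heq hm).trans (Category.comp_id a).symm)
  rw [hc]
  rfl

end Arr

/-! ### Matched pairs -/

/-- A matched pair of groupoids `(V, H)` with the same base: a left action `x ▷ g` of `H` on
the source map of `V` and a right action `x ◁ g` of `V` on the end map of `H`,
both defined when the end of `x` is the source of `g`, and compatible with each other. -/
structure MatchedPair {P : Type u} (V : Groupoid.{v} P) (H : Groupoid.{w} P) where
  /-- `x ▷ g` -/
  left (x : Arr H) (g : Arr V) (h : x.tgt = g.src) : Arr V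
  /-- `x ◁ g` -/
  right (x : Arr H) (g : Arr V) (h : x.tgt = g.src) : Arr H
  left_src (x : Arr H) (g : Arr V) (h : x.tgt = g.src) : (left x g h).src = x.src
  left_left (x y : Arr H) (g : Arr V) (h : x.tgt = y.src) (h' : y.tgt = g.src) :
    left x (left y g h') (h.trans (left_src y g h').symm) = left (x.comp y h) g h'
  one_left (g : Arr V) : left (Arr.one H g.src) g rfl = g
  right_tgt (x : Arr H) (g : Arr V) (h : x.tgt = g.src) : (right x g h).tgt = g.tgt
  right_right (x : Arr H) (f g : Arr V) (h : x.tgt = f.src) (h' : f.tgt = g.src) :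
    right (right x f h) g ((right_tgt x f h).trans h') = right x (f.comp g h') h
  right_one (x : Arr H) : right x (Arr.one V x.tgt) rfl = x
  corner (x : Arr H) (g : Arr V) (h : x.tgt = g.src) : (left x g h).tgt = (right x g h).src
  /-- `x ▷ f g = (x ▷ f) ((x ◁ f) ▷ g)` -/
  left_comp (x : Arr H) (f g : Arr V) (h : x.tgt = f.src) (h' : f.tgt = g.src) :
    left x (f.comp g h') h =
      (left x f h).comp (left (right x f h) g ((right_tgt x f h).trans h'))
        ((corner x f h).trans (left_src _ _ _).symm)
  /-- `x y ◁ g = (x ◁ (y ▷ g)) (y ◁ g)` -/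
  comp_right (x y : Arr H) (g : Arr V) (h : x.tgt = y.src) (h' : y.tgt = g.src) :
    right (x.comp y h) g h' =
      (right x (left y g h') (h.trans (left_src y g h').symm)).comp (right y g h')
        ((right_tgt _ _ _).trans (corner y g h'))

section Rotations

variable {P : Type u} {V : Groupoid.{v} P} {H : Groupoid.{w} P}

/-- A rotation: a morphism of groupoids `κ : V → H` over the base (a functor that is the identity on
objects) such that `y κ(g) = κ(y ▷ g) (y ◁ g)` whenever the end of `y` is the source of `g`. -/
structure Rotation (M : MatchedPair V H) where
  map : Arr V → Arr H
  map_src (g : Arr V) : (map g).src = g.src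
  map_tgt (g : Arr V) : (map g).tgt = g.tgt
  map_one (p : P) : map (Arr.one V p) = Arr.one H p
  map_comp (f g : Arr V) (h : f.tgt = g.src) :
    map (f.comp g h) = (map f).comp (map g) ((map_tgt f).trans (h.trans (map_src g).symm))
  rotate (y : Arr H) (g : Arr V) (h : y.tgt = g.src) :
    y.comp (map g) (h.trans (map_src g).symm) =
      (map (M.left y g h)).comp (M.right y g h) ((map_tgt _).trans (M.corner y g h))

variable {M : MatchedPair V H}

theorem Rotation.map_tgt_eq (κ : Rotation M) {f g : Arr V} (h : g.tgt = f.src) :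
    (κ.map g).tgt = f.src := (κ.map_tgt g).trans h

theorem Rotation.inv_tgt_eq (κ : Rotation M) {f g : Arr V} (h : g.tgt = f.src) :
    (κ.map f).inv.tgt = g.inv.src := (κ.map_src f).trans h.symm

/-- Matched pairs of rotations `(ξ, η)`: for all composable `g`, `f` (in this order), the ends of
`η(g) ▷ f` and `ξ(f)⁻¹ ▷ g⁻¹` agree and `(η(g) ▷ f) (ξ(f)⁻¹ ▷ g⁻¹)⁻¹ = g f`. -/
def IsMatchedRotations (ξ η : Rotation M) : Prop :=
  ∀ (f g : Arr V) (h : g.tgt = f.src),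
    ∃ hb : (M.left (η.map g) f (η.map_tgt_eq h)).tgt =
        (M.left (ξ.map f).inv g.inv (ξ.inv_tgt_eq h)).tgt,
      (M.left (η.map g) f (η.map_tgt_eq h)).comp
        (M.left (ξ.map f).inv g.inv (ξ.inv_tgt_eq h)).inv hb = g.comp f h

end Rotations

/-! ### Cells -/

section Cells

variable {P : Type u} {V : Groupoid.{v} P} {H : Groupoid.{w} P}

/-- A cell `(x, g)` of a matched pair: `x` in `H` and `g` in `V` with `x.tgt = g.src`. -/
@[ext] structure Cell (M : MatchedPair V H) where
  hor : Arr H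
  ver : Arr V
  eq : hor.tgt = ver.src

namespace Cell

variable {M : MatchedPair V H}

/-- `x ▷ g` for the cell `(x, g)`. -/
def left (A : Cell M) : Arr V := M.left A.hor A.ver A.eq

/-- `x ◁ g` for the cell `(x, g)`. -/
def bot (A : Cell M) : Arr H := M.right A.hor A.ver A.eq

theorem left_src (A : Cell M) : A.left.src = A.hor.src := M.left_src _ _ _
theorem bot_tgt (A : Cell M) : A.bot.tgt = A.ver.tgt := M.right_tgt _ _ _
theorem left_tgt (A : Cell M) : A.left.tgt = A.bot.src := M.corner _ _ _

/-- Horizontal composition `(x, g) (y, f) = (x y, f)`, defined when `g = y ▷ f`. -/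
def hcomp (A B : Cell M) (h : A.ver = B.left) : Cell M :=
  ⟨A.hor.comp B.hor (A.eq.trans ((congrArg Arr.src h).trans B.left_src)), B.ver, B.eq⟩

/-- Vertical composition of `(x, g)` on top of `(y, f)`, equal to `(x, g f)`,
defined when `y = x ◁ g`. -/
def vcomp (A B : Cell M) (h : A.bot = B.hor) : Cell M :=
  ⟨A.hor, A.ver.comp B.ver (A.bot_tgt.symm.trans ((congrArg Arr.tgt h).trans B.eq)), A.eq⟩

/-- The identity of `g` for the horizontal composition. -/
def idH (M : MatchedPair V H) (g : Arr V) : Cell M := ⟨Arr.one H g.src, g, rfl⟩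

/-- The identity of `x` for the vertical composition. -/
def idV (M : MatchedPair V H) (x : Arr H) : Cell M := ⟨x, Arr.one V x.tgt, rfl⟩

/-- The inverse cell `((x ◁ g)⁻¹, (x ▷ g)⁻¹)`. -/
def inv (A : Cell M) : Cell M := ⟨A.bot.inv, A.left.inv, A.left_tgt.symm⟩

/-- `A` and `B` are vertically composable and their vertical composition is `C`. -/
def IsVComp (A B C : Cell M) : Prop := ∃ h : A.bot = B.hor, A.vcomp B h = C

theorem left_idH (g : Arr V) : (idH M g).left = g := M.one_left g

theorem left_hcomp (A B : Cell M) (h : A.ver = B.left) : (A.hcomp B h).left = A.left := by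
  obtain ⟨x, g, e⟩ := A
  obtain ⟨y, f, e'⟩ := B
  change g = M.left y f e' at h
  subst h
  exact (M.left_left _ _ _ _ _).symm

theorem bot_idV (x : Arr H) : (idV M x).bot = x := M.right_one x

theorem bot_vcomp (A B : Cell M) (h : A.bot = B.hor) : (A.vcomp B h).bot = B.bot := by
  obtain ⟨x, g, e⟩ := A
  obtain ⟨y, f, e'⟩ := B
  change M.right x g e = y at h
  subst h
  exact (M.right_right _ _ _ _ _).symm

/-- `id ◁ g = id` -/
theorem bot_idH (g : Arr V) : (idH M g).bot = Arr.one H g.tgt := by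
  have h := M.comp_right (Arr.one H g.src) (Arr.one H g.src) g rfl rfl
  simp only [M.one_left] at h
  have hz : ∀ (z : Arr H) (e : z.tgt = g.src), z = Arr.one H g.src →
      M.right z g e = M.right (Arr.one H g.src) g rfl := by
    rintro _ _ rfl
    rfl
  have h2 := Arr.eq_one_of_comp_eq _ _ _
    (h.symm.trans (hz _ _ (Arr.one_comp g.src (Arr.one H g.src) rfl)))
  have h3 : (M.right (Arr.one H g.src) g rfl).src = g.tgt := by
    exact (M.corner _ _ _).symm.trans (congrArg Arr.tgt (M.one_left g))
  rw [h3] at h2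
  exact h2

theorem hcomp_assoc (A B C : Cell M) (h : A.ver = B.left) (h' : B.ver = C.left) :
    (A.hcomp B h).hcomp C h' = A.hcomp (B.hcomp C h') (h.trans (left_hcomp B C h').symm) := by
  ext1
  · exact Arr.assoc _ _ _ _ _
  · rfl

theorem idH_hcomp (g : Arr V) (A : Cell M) (h : g = A.left) : (idH M g).hcomp A h = A := by
  ext1
  · exact Arr.one_comp _ _ _
  · rfl

theorem hcomp_idH (A : Cell M) : A.hcomp (idH M A.ver) (left_idH A.ver).symm = A := by
  ext1
  · exact Arr.comp_one _ _ A.eq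
  · rfl

theorem vcomp_assoc (A B C : Cell M) (h : A.bot = B.hor) (h' : B.bot = C.hor) :
    (A.vcomp B h).vcomp C ((bot_vcomp A B h).trans h') = A.vcomp (B.vcomp C h') h := by
  ext1
  · rfl
  · exact Arr.assoc _ _ _ _ _

theorem idV_isVComp (x : Arr H) (A C : Cell M) : IsVComp (idV M x) A C ↔ x = A.hor ∧ A = C := by
  constructor
  · rintro ⟨h, rfl⟩
    have hx : x = A.hor := (bot_idV x).symm.trans h
    refine ⟨hx, ?_⟩
    ext1
    · exact hx.symm
    · exact (Arr.one_comp _ _ _).symm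
  · rintro ⟨rfl, rfl⟩
    refine ⟨bot_idV _, ?_⟩
    ext1
    · rfl
    · exact Arr.one_comp _ _ _

theorem isVComp_idV (x : Arr H) (A C : Cell M) : IsVComp A (idV M x) C ↔ A.bot = x ∧ A = C := by
  constructor
  · rintro ⟨h, rfl⟩
    refine ⟨h, ?_⟩
    ext1
    · rfl
    · exact (Arr.comp_one _ _ _).symm
  · rintro ⟨h, rfl⟩
    refine ⟨h, ?_⟩
    ext1
    · rfl
    · exact Arr.comp_one _ _ _

theorem isVComp_assoc (A B C D : Cell M) :
    (∃ W, IsVComp A B W ∧ IsVComp W C D) ↔ ∃ W, IsVComp B C W ∧ IsVComp A W D := by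
  constructor
  · rintro ⟨W, ⟨h, rfl⟩, h', rfl⟩
    exact ⟨B.vcomp C ((bot_vcomp A B h).symm.trans h'), ⟨_, rfl⟩, h, (vcomp_assoc _ _ _ _ _).symm⟩
  · rintro ⟨W, ⟨h, rfl⟩, h', rfl⟩
    exact ⟨A.vcomp B h', ⟨_, rfl⟩, (bot_vcomp A B h').trans h, vcomp_assoc _ _ _ _ _⟩

theorem IsVComp.unique {A B C D : Cell M} (h : IsVComp A B C) (h' : IsVComp A B D) : C = D := by
  obtain ⟨_, rfl⟩ := h
  obtain ⟨_, rfl⟩ := h'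
  rfl

instance [Finite (Arr V)] [Finite (Arr H)] : Finite (Cell M) :=
  Finite.of_injective (fun A : Cell M => (A.hor, A.ver)) fun A B h => by
    ext1
    · exact congrArg Prod.fst h
    · exact congrArg Prod.snd h

noncomputable instance [Fintype (Arr V)] [Fintype (Arr H)] : Fintype (Cell M) := Fintype.ofFinite _

end Cell

end Cells

/-! ### The weak Hopf algebra of a matched pair -/

section Algebra

variable {P : Type u} {V : Groupoid.{v} P} {H : Groupoid.{w} P}

/-- The vector space `k(V, H)` with basis the cells of the matched pair. -/
def CellAlg (k : Type*) [Field k] (M : MatchedPair V H) : Type _ := Cell M →₀ k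

namespace CellAlg

variable (k : Type*) [Field k] {M : MatchedPair V H}

noncomputable instance : AddCommGroup (CellAlg k M) := inferInstanceAs (AddCommGroup (Cell M →₀ k))

noncomputable instance : Module k (CellAlg k M) := inferInstanceAs (Module k (Cell M →₀ k))

/-- The basis element given by a cell. -/
noncomputable def of (A : Cell M) : CellAlg k M := Finsupp.single A (1 : k)

/-- The linear map with prescribed values on cells. -/
noncomputable def lift {E : Type*} [AddCommGroup E] [Module k E] (f : Cell M → E) :
    CellAlg k M →ₗ[k] E := Finsupp.linearCombination k f

variable {k}

@[simp] theorem lift_of {E : Type*} [AddCommGroup E] [Module k E] (f : Cell M → E) (A : Cell M) :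
    lift k f (of k A) = f A :=
  (Finsupp.linearCombination_single k (1 : k) A).trans (one_smul k (f A))

theorem hom_ext {E : Type*} [AddCommGroup E] [Module k E] {f g : CellAlg k M →ₗ[k] E}
    (h : ∀ A, f (of k A) = g (of k A)) : f = g :=
  Finsupp.lhom_ext' fun A => LinearMap.ext_ring (h A)

variable (k)

open Classical in
/-- The product of two cells: their horizontal composition if it is defined, else zero. -/
noncomputable def cellMul (A B : Cell M) : CellAlg k M :=
  if h : A.ver = B.left then of k (A.hcomp B h) else 0

/-- The multiplication, as a bilinear map. -/
noncomputable def mulMap : CellAlg k M →ₗ[k] CellAlg k M →ₗ[k] CellAlg k M :=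
  lift k fun A => lift k fun B => cellMul k A B

noncomputable instance : Mul (CellAlg k M) := ⟨fun a b => mulMap k a b⟩

theorem mul_def (a b : CellAlg k M) : a * b = mulMap k a b := rfl

theorem of_mul_of (A B : Cell M) : of k A * of k B = cellMul k A B := by
  simp [mul_def, mulMap]

theorem mulMap_assoc (a b c : CellAlg k M) :
    mulMap k (mulMap k a b) c = mulMap k a (mulMap k b c) := by
  have key : (mulMap k (M := M)).compr₂ (mulMap k (M := M)) =
      (LinearMap.llcomp k _ _ _).flip (mulMap k (M := M)) ∘ₗ
        (LinearMap.llcomp k _ _ _) ∘ₗ (mulMap k (M := M)) := by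
    refine hom_ext fun A => hom_ext fun B => hom_ext fun C => ?_
    simp only [LinearMap.compr₂_apply, LinearMap.comp_apply, LinearMap.flip_apply,
      LinearMap.llcomp_apply, mulMap, lift_of]
    by_cases h1 : A.ver = B.left <;> by_cases h2 : B.ver = C.left
    · have h3 : A.ver = (B.hcomp C h2).left := h1.trans (Cell.left_hcomp B C h2).symm
      have h4 : (A.hcomp B h1).ver = C.left := h2
      simp only [cellMul, dif_pos h1, dif_pos h2, lift_of, dif_pos h3, dif_pos h4]
      exact congrArg (of k) (Cell.hcomp_assoc A B C h1 h2)
    · have h4 : ¬ (A.hcomp B h1).ver = C.left := h2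
      simp only [cellMul, dif_pos h1, dif_neg h2, lift_of, dif_neg h4, map_zero]
    · have h3 : ¬ A.ver = (B.hcomp C h2).left := fun e => h1 (e.trans (Cell.left_hcomp B C h2))
      simp only [cellMul, dif_neg h1, dif_pos h2, lift_of, dif_neg h3, map_zero,
        LinearMap.zero_apply]
    · simp only [cellMul, dif_neg h1, dif_neg h2, map_zero, LinearMap.zero_apply]
  exact congrArg (fun F => F a b c) key

variable [Fintype (Arr V)]

/-- The unit: the sum of the horizontal identities of all vertical arrows. -/
noncomputable instance : One (CellAlg k M) := ⟨∑ g : Arr V, of k (Cell.idH M g)⟩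

theorem one_def : (1 : CellAlg k M) = ∑ g : Arr V, of k (Cell.idH M g) := rfl

theorem one_mulMap (a : CellAlg k M) : mulMap k 1 a = a := by
  classical
  have key : mulMap k (1 : CellAlg k M) = LinearMap.id := by
    refine hom_ext fun A => ?_
    rw [one_def, map_sum, LinearMap.sum_apply, Finset.sum_eq_single A.left]
    · have h : (Cell.idH M A.left).ver = A.left := rfl
      simp only [mulMap, lift_of, cellMul, dif_pos h]
      exact congrArg (of k) (Cell.idH_hcomp _ A rfl)
    · intro g _ hg
      have h : ¬ (Cell.idH M g).ver = A.left := hg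
      simp only [mulMap, lift_of, cellMul, dif_neg h]
    · intro h
      exact absurd (Finset.mem_univ _) h
  rw [key]
  rfl

theorem mulMap_one (a : CellAlg k M) : mulMap k a 1 = a := by
  classical
  have key : (mulMap k).flip (1 : CellAlg k M) = LinearMap.id := by
    refine hom_ext fun A => ?_
    rw [LinearMap.flip_apply, one_def, map_sum, Finset.sum_eq_single A.ver]
    · have h : A.ver = (Cell.idH M A.ver).left := (Cell.left_idH _).symm
      simp only [mulMap, lift_of, cellMul, dif_pos h]
      exact congrArg (of k) (Cell.hcomp_idH A)
    · intro g _ hg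
      have h : ¬ A.ver = (Cell.idH M g).left := fun e => hg (e.trans (Cell.left_idH _)).symm
      simp only [mulMap, lift_of, cellMul, dif_neg h]
    · intro h
      exact absurd (Finset.mem_univ _) h
  exact congrArg (fun F => F a) key

noncomputable instance : Ring (CellAlg k M) where
  __ := (inferInstance : AddCommGroup (CellAlg k M))
  mul := (· * ·)
  one := 1
  left_distrib a b c := map_add (mulMap k a) b c
  right_distrib a b c := by simp only [mul_def, map_add, LinearMap.add_apply]
  zero_mul a := by simp only [mul_def, map_zero, LinearMap.zero_apply]
  mul_zero a := map_zero (mulMap k a)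
  mul_assoc := mulMap_assoc k
  one_mul := one_mulMap k
  mul_one := mulMap_one k

noncomputable instance : Algebra k (CellAlg k M) :=
  Algebra.ofModule
    (fun r a b => by simp only [mul_def, map_smul, LinearMap.smul_apply])
    (fun r a b => by simp only [mul_def, map_smul])

variable [Fintype (Arr H)]

open Classical in
/-- The comultiplication: a cell goes to the sum of `B ⊗ C` over all pairs of vertically composable
cells with vertical composition the given one. The counit: `1` on vertical identities, else `0`. -/
noncomputable instance : CoalgebraStruct k (CellAlg k M) where
  comul := lift k fun A => ∑ B : Cell M, ∑ C : Cell M,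
    if Cell.IsVComp B C A then of k B ⊗ₜ[k] of k C else 0
  counit := lift k fun A => if ∃ x : Arr H, A = Cell.idV M x then 1 else 0

open Classical in
theorem comul_of (A : Cell M) : Coalgebra.comul (R := k) (of k A) = ∑ B : Cell M, ∑ C : Cell M,
    if Cell.IsVComp B C A then of k B ⊗ₜ[k] of k C else 0 := lift_of _ A

open Classical in
theorem counit_of (A : Cell M) : Coalgebra.counit (R := k) (of k A) =
    if ∃ x : Arr H, A = Cell.idV M x then (1 : k) else 0 := lift_of _ A

theorem sum_ite_unique {ι E : Type*} [Fintype ι] [AddCommMonoid E] (p : ι → Prop) (t : E)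
    [DecidablePred p] [Decidable (∃ i, p i)]
    (hp : ∀ i j, p i → p j → i = j) :
    (∑ i, if p i then t else 0) = if ∃ i, p i then t else 0 := by
  by_cases h : ∃ i, p i
  · obtain ⟨i, hi⟩ := h
    rw [if_pos ⟨i, hi⟩, Finset.sum_eq_single i, if_pos hi]
    · intro j _ hn
      exact if_neg fun h' => hn (hp _ _ h' hi)
    · intro h'
      exact absurd (Finset.mem_univ _) h'
  · rw [if_neg h]
    exact Finset.sum_eq_zero fun i _ => if_neg fun h' => h ⟨i, h'⟩

open Classical in
theorem comul_comul_left (A : Cell M) :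
    TensorProduct.assoc k _ _ _ ((Coalgebra.comul (R := k)).rTensor (CellAlg k M)
      (Coalgebra.comul (R := k) (of k A))) = ∑ X : Cell M, ∑ Y : Cell M, ∑ Z : Cell M,
      if ∃ W, Cell.IsVComp X Y W ∧ Cell.IsVComp W Z A then
        of k X ⊗ₜ[k] (of k Y ⊗ₜ[k] of k Z) else 0 := by
  have e : ∀ X Y Z : Cell M, (if ∃ W, Cell.IsVComp X Y W ∧ Cell.IsVComp W Z A then
        of k X ⊗ₜ[k] (of k Y ⊗ₜ[k] of k Z) else 0) =
      ∑ W : Cell M, if Cell.IsVComp X Y W ∧ Cell.IsVComp W Z A then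
        of k X ⊗ₜ[k] (of k Y ⊗ₜ[k] of k Z) else 0 := fun X Y Z =>
    (sum_ite_unique (fun W => Cell.IsVComp X Y W ∧ Cell.IsVComp W Z A) _
      fun _ _ h h' => h.1.unique h'.1).symm
  simp only [e, comul_of, map_sum]
  rw [Finset.sum_comm]
  have e2 : ∀ Z W : Cell M, TensorProduct.assoc k _ _ _
      ((Coalgebra.comul (R := k)).rTensor (CellAlg k M)
        (if Cell.IsVComp W Z A then of k W ⊗ₜ[k] of k Z else 0)) =
      ∑ X : Cell M, ∑ Y : Cell M, if Cell.IsVComp X Y W ∧ Cell.IsVComp W Z A then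
        of k X ⊗ₜ[k] (of k Y ⊗ₜ[k] of k Z) else 0 := by
    intro Z W
    by_cases h : Cell.IsVComp W Z A
    · simp only [h, if_true, and_true, LinearMap.rTensor_tmul, comul_of, sum_tmul, map_sum]
      refine Finset.sum_congr rfl fun X _ => Finset.sum_congr rfl fun Y _ => ?_
      by_cases h' : Cell.IsVComp X Y W
      · simp only [h', if_true, TensorProduct.assoc_tmul]
      · simp only [h', if_false, zero_tmul, LinearEquiv.map_zero]
    · simp only [h, if_false, and_false, LinearMap.map_zero, LinearEquiv.map_zero,
        Finset.sum_const_zero]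
  simp only [e2]
  calc _ = ∑ Z : Cell M, ∑ X : Cell M, ∑ Y : Cell M, ∑ W : Cell M,
        if Cell.IsVComp X Y W ∧ Cell.IsVComp W Z A then
          of k X ⊗ₜ[k] (of k Y ⊗ₜ[k] of k Z) else 0 := by
        refine Finset.sum_congr rfl fun Z _ => ?_
        rw [Finset.sum_comm]
        exact Finset.sum_congr rfl fun X _ => Finset.sum_comm
    _ = _ := by
        rw [Finset.sum_comm]
        exact Finset.sum_congr rfl fun X _ => Finset.sum_comm

open Classical in
theorem comul_comul_right (A : Cell M) :
    (Coalgebra.comul (R := k)).lTensor (CellAlg k M)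
      (Coalgebra.comul (R := k) (of k A)) = ∑ X : Cell M, ∑ Y : Cell M, ∑ Z : Cell M,
      if ∃ W, Cell.IsVComp Y Z W ∧ Cell.IsVComp X W A then
        of k X ⊗ₜ[k] (of k Y ⊗ₜ[k] of k Z) else 0 := by
  have e : ∀ X Y Z : Cell M, (if ∃ W, Cell.IsVComp Y Z W ∧ Cell.IsVComp X W A then
        of k X ⊗ₜ[k] (of k Y ⊗ₜ[k] of k Z) else 0) =
      ∑ W : Cell M, if Cell.IsVComp Y Z W ∧ Cell.IsVComp X W A then
        of k X ⊗ₜ[k] (of k Y ⊗ₜ[k] of k Z) else 0 := fun X Y Z =>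
    (sum_ite_unique (fun W => Cell.IsVComp Y Z W ∧ Cell.IsVComp X W A) _
      fun _ _ h h' => h.1.unique h'.1).symm
  simp only [e, comul_of, map_sum]
  have e2 : ∀ X W : Cell M,
      (Coalgebra.comul (R := k)).lTensor (CellAlg k M)
        (if Cell.IsVComp X W A then of k X ⊗ₜ[k] of k W else 0) =
      ∑ Y : Cell M, ∑ Z : Cell M, if Cell.IsVComp Y Z W ∧ Cell.IsVComp X W A then
        of k X ⊗ₜ[k] (of k Y ⊗ₜ[k] of k Z) else 0 := by
    intro X W
    by_cases h : Cell.IsVComp X W A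
    · simp only [h, if_true, and_true, LinearMap.lTensor_tmul, comul_of, tmul_sum]
      refine Finset.sum_congr rfl fun Y _ => Finset.sum_congr rfl fun Z _ => ?_
      by_cases h' : Cell.IsVComp Y Z W
      · simp only [h', if_true]
      · simp only [h', if_false, tmul_zero]
    · simp only [h, if_false, and_false, map_zero, Finset.sum_const_zero]
  simp only [e2]
  refine Finset.sum_congr rfl fun X _ => ?_
  rw [Finset.sum_comm]
  exact Finset.sum_congr rfl fun Y _ => Finset.sum_comm

theorem counit_comul_left (A : Cell M) :
    (Coalgebra.counit (R := k)).rTensor (CellAlg k M) (Coalgebra.comul (R := k) (of k A)) =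
      1 ⊗ₜ[k] of k A := by
  classical
  simp only [comul_of, map_sum]
  rw [Finset.sum_eq_single (Cell.idV M A.hor), Finset.sum_eq_single A]
  · rw [if_pos ((Cell.idV_isVComp _ _ _).2 ⟨rfl, rfl⟩), LinearMap.rTensor_tmul, counit_of,
      if_pos ⟨_, rfl⟩]
  · intro C _ hC
    rw [if_neg fun h => hC ((Cell.idV_isVComp _ _ _).1 h).2, map_zero]
  · intro h
    exact absurd (Finset.mem_univ _) h
  · intro B _ hB
    refine Finset.sum_eq_zero fun C _ => ?_
    by_cases h : Cell.IsVComp B C A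
    · rw [if_pos h, LinearMap.rTensor_tmul, counit_of, if_neg, zero_tmul]
      rintro ⟨x, rfl⟩
      have h' := (Cell.idV_isVComp _ _ _).1 h
      exact hB (by rw [h'.1, h'.2])
    · rw [if_neg h, map_zero]
  · intro h
    exact absurd (Finset.mem_univ _) h

theorem counit_comul_right (A : Cell M) :
    (Coalgebra.counit (R := k)).lTensor (CellAlg k M) (Coalgebra.comul (R := k) (of k A)) =
      of k A ⊗ₜ[k] 1 := by
  classical
  simp only [comul_of, map_sum]
  rw [Finset.sum_eq_single A, Finset.sum_eq_single (Cell.idV M A.bot)]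
  · rw [if_pos ((Cell.isVComp_idV _ _ _).2 ⟨rfl, rfl⟩), LinearMap.lTensor_tmul, counit_of,
      if_pos ⟨_, rfl⟩]
  · intro C _ hC
    by_cases h : Cell.IsVComp A C A
    · rw [if_pos h, LinearMap.lTensor_tmul, counit_of, if_neg, tmul_zero]
      rintro ⟨x, rfl⟩
      exact hC (by rw [((Cell.isVComp_idV _ _ _).1 h).1])
    · rw [if_neg h, map_zero]
  · intro h
    exact absurd (Finset.mem_univ _) h
  · intro B _ hB
    refine Finset.sum_eq_zero fun C _ => ?_
    by_cases h : Cell.IsVComp B C A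
    · rw [if_pos h, LinearMap.lTensor_tmul, counit_of, if_neg, tmul_zero]
      rintro ⟨x, rfl⟩
      exact hB ((Cell.isVComp_idV _ _ _).1 h).2
    · rw [if_neg h, map_zero]
  · intro h
    exact absurd (Finset.mem_univ _) h

noncomputable instance : Coalgebra k (CellAlg k M) where
  coassoc := hom_ext fun A => by
    classical
    refine (comul_comul_left k A).trans (Eq.trans ?_ (comul_comul_right k A).symm)
    simp only [Cell.isVComp_assoc]
  rTensor_counit_comp_comul := hom_ext (counit_comul_left k)
  lTensor_counit_comp_comul := hom_ext (counit_comul_right k)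

/-- The antipode: a cell goes to its inverse. -/
noncomputable def antipode : CellAlg k M →ₗ[k] CellAlg k M := lift k fun A => of k A.inv

open Classical in
/-- The element `R = ∑ (ξ(f)⁻¹ ◁ g⁻¹, g) ⊗ (η(g), f)`, the sum being over all pairs `f`, `g` of arrows
of `V` such that `g f` is defined. -/
noncomputable def rMatrix (ξ η : Rotation M) : CellAlg k M ⊗[k] CellAlg k M :=
  ∑ f : Arr V, ∑ g : Arr V,
    if h : g.tgt = f.src then
      of k (⟨M.right (ξ.map f).inv g.inv (ξ.inv_tgt_eq h), g, M.right_tgt _ _ _⟩ : Cell M) ⊗ₜ[k]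
        of k (⟨η.map g, f, η.map_tgt_eq h⟩ : Cell M)
    else 0

end CellAlg

end Algebra

/-! ### Weak Hopf algebras and quasitriangular structures -/

section Weak

variable (k : Type*) (A : Type*) [Field k] [Ring A] [Algebra k A] [Coalgebra k A]

/-- A weak bialgebra. Triple tensor products are written `A ⊗ (A ⊗ A)`. -/
structure IsWeakBialgebra : Prop where
  comul_mul (a b : A) :
    Coalgebra.comul (R := k) (a * b) = Coalgebra.comul (R := k) a * Coalgebra.comul (R := k) b
  /-- `(Δ(1) ⊗ 1)(1 ⊗ Δ(1)) = (id ⊗ Δ)Δ(1)` -/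
  comul_one : TensorProduct.assoc k A A A (Coalgebra.comul (R := k) (1 : A) ⊗ₜ[k] (1 : A)) *
      ((1 : A) ⊗ₜ[k] Coalgebra.comul (R := k) (1 : A)) =
    (Coalgebra.comul (R := k)).lTensor A (Coalgebra.comul (R := k) (1 : A))
  /-- `(1 ⊗ Δ(1))(Δ(1) ⊗ 1) = (id ⊗ Δ)Δ(1)` -/
  comul_one' : ((1 : A) ⊗ₜ[k] Coalgebra.comul (R := k) (1 : A)) *
      TensorProduct.assoc k A A A (Coalgebra.comul (R := k) (1 : A) ⊗ₜ[k] (1 : A)) =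
    (Coalgebra.comul (R := k)).lTensor A (Coalgebra.comul (R := k) (1 : A))
  /-- `ε(a b₁) ε(b₂ c) = ε(a b c)` -/
  counit_mul (a b c : A) :
    LinearMap.mul' k k (TensorProduct.map
      (Coalgebra.counit (R := k) ∘ₗ LinearMap.mulLeft k a)
      (Coalgebra.counit (R := k) ∘ₗ LinearMap.mulRight k c) (Coalgebra.comul (R := k) b)) =
    Coalgebra.counit (R := k) (a * b * c)
  /-- `ε(a b₂) ε(b₁ c) = ε(a b c)` -/
  counit_mul' (a b c : A) :
    LinearMap.mul' k k (TensorProduct.map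
      (Coalgebra.counit (R := k) ∘ₗ LinearMap.mulRight k c)
      (Coalgebra.counit (R := k) ∘ₗ LinearMap.mulLeft k a) (Coalgebra.comul (R := k) b)) =
    Coalgebra.counit (R := k) (a * b * c)

variable {A}

/-- The source map `ε_s(h) = (id ⊗ ε)((1 ⊗ h) Δ(1))`. -/
noncomputable def sourceMap (h : A) : A :=
  TensorProduct.rid k A ((Coalgebra.counit (R := k)).lTensor A
    (((1 : A) ⊗ₜ[k] h) * Coalgebra.comul (R := k) (1 : A)))

/-- The target map `ε_e(h) = (ε ⊗ id)(Δ(1) (h ⊗ 1))`. -/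
noncomputable def targetMap (h : A) : A :=
  TensorProduct.lid k A ((Coalgebra.counit (R := k)).rTensor A
    (Coalgebra.comul (R := k) (1 : A) * (h ⊗ₜ[k] (1 : A))))

/-- `S` is an antipode: `S(h₁) h₂ = ε_s(h)`, `h₁ S(h₂) = ε_e(h)`, `S(h₁) h₂ S(h₃) = S(h)`. -/
structure IsAntipode (S : A →ₗ[k] A) : Prop where
  antipode_mul (h : A) :
    LinearMap.mul' k A (TensorProduct.map S LinearMap.id (Coalgebra.comul (R := k) h)) =
      sourceMap k h
  mul_antipode (h : A) :
    LinearMap.mul' k A (TensorProduct.map LinearMap.id S (Coalgebra.comul (R := k) h)) =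
      targetMap k h
  antipode_mul_antipode (h : A) :
    LinearMap.mul' k A (TensorProduct.map S
      (LinearMap.mul' k A ∘ₗ TensorProduct.map LinearMap.id S ∘ₗ Coalgebra.comul (R := k))
      (Coalgebra.comul (R := k) h)) = S h

variable (A)

/-- A weak Hopf algebra: a weak bialgebra that has an antipode. -/
structure IsWeakHopfAlgebra : Prop extends IsWeakBialgebra k A where
  exists_antipode : ∃ S : A →ₗ[k] A, IsAntipode k S

variable {A}

/-- The opposite comultiplication. -/
noncomputable def comulOp : A →ₗ[k] A ⊗[k] A :=
  (TensorProduct.comm k A A).toLinearMap ∘ₗ Coalgebra.comul (R := k)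

/-- `R₁₂ = R ⊗ 1` -/
noncomputable def leg12 (R : A ⊗[k] A) : A ⊗[k] (A ⊗[k] A) :=
  TensorProduct.assoc k A A A (R ⊗ₜ[k] (1 : A))

/-- `R₂₃ = 1 ⊗ R` -/
noncomputable def leg23 (R : A ⊗[k] A) : A ⊗[k] (A ⊗[k] A) := (1 : A) ⊗ₜ[k] R

/-- `R₁₃`: `a ⊗ b` goes to `a ⊗ 1 ⊗ b`. -/
noncomputable def leg13 (R : A ⊗[k] A) : A ⊗[k] (A ⊗[k] A) :=
  (TensorProduct.mk k A A 1).lTensor A R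

/-- `(A, R)` is a quasitriangular weak Hopf algebra. -/
structure IsQuasitriangular (R : A ⊗[k] A) : Prop extends IsWeakHopfAlgebra k A where
  /-- `R` lies in `Δᶜᵒᵖ(1) (A ⊗ A) Δ(1)` -/
  mem : ∃ T : A ⊗[k] A, R = comulOp k (1 : A) * T * Coalgebra.comul (R := k) (1 : A)
  comulOp_mul (h : A) : comulOp k h * R = R * Coalgebra.comul (R := k) h
  id_comul : (Coalgebra.comul (R := k)).lTensor A R = leg13 k R * leg12 k R
  comul_id : TensorProduct.assoc k A A A ((Coalgebra.comul (R := k)).rTensor A R) =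
    leg13 k R * leg23 k R
  exists_inv : ∃ R' : A ⊗[k] A,
    (∃ T : A ⊗[k] A, R' = Coalgebra.comul (R := k) (1 : A) * T * comulOp k (1 : A)) ∧
      R * R' = comulOp k (1 : A) ∧ R' * R = Coalgebra.comul (R := k) (1 : A)

end Weak

end MatchedGpd

/-!
A cell `(x, g)` is viewed as a square with top edge `x = hor`, right edge `g = ver`, left edge
`x ▷ g = left` and bottom edge `x ◁ g = bot`. The axioms of a matched pair say that such squares form
a double groupoid in which a square is determined by two adjacent edges (`Cell.ext_left`,
`Cell.ext_bot`). All identities to be shown equate sums of pure tensors of cells, and reduce to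
bijections between the index sets.

Vertical decompositions of a cell correspond to factorizations of its right edge
(`CellAlg.comul_of_eq_sum`) and also to factorizations of its left edge (`Cell.splitEquiv`). So `Δ` is
multiplicative by the interchange law, `Δ(1)` is the indicator of the composable pairs in `V`, and
the counit and antipode axioms hold because only cuts with a trivial half, or cells that are vertical
identities, contribute.

For a composable pair `p = (g, f)` the corresponding summand of `R` is `X ⊗ Y` with `X = ξ.cellX p` and
`Y = η.cellY p`. The right edges of `X`, `Y` are `g`, `f`; let `g'`, `f'` be the left edges. The
matching condition says that `f' g' = g f`, which gives the map `IsMatchedRotations.braid`, sending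
`(g, f)` to `(f', g')`. The rotation identity `x κ(r) = κ(l) b` for squares then gives all edges:
`X` has top `ξ(f')⁻¹` and bottom `ξ(f)⁻¹`, and `Y` has top `η(g)` and bottom `η(g')`
(`hor_cellX`, `bot_cellX`, `bot_cellY`). Everything follows:
* the braiding is injective, hence bijective, so that the sum of the horizontal inverses of the
  summands is the inverse of `R` (`exists_inv_rMatrix`);
* the braiding is natural with respect to cells (`upper_hcomp_cellY`, `lower_hcomp_cellX`), which is
  `Δᶜᵒᵖ(h) R = R Δ(h)`;
* cutting `Y` vertically along `f = f₁ f₂` matches the horizontal composition of the corresponding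
  two cells `X`, and similarly for `g = g₁ g₂` (`cellX_hcomp_cellX`, `cellY_hcomp_cellY`), which are
  the two hexagon identities.
-/

open CategoryTheory TensorProduct

namespace MatchedGpd

universe u v w

/-! ### Arrows and composable pairs -/

namespace Arr

variable {P : Type u} {G : Groupoid.{v} P}

theorem comp_left_cancel {f g g' : Arr G} {h : f.tgt = g.src} {h' : f.tgt = g'.src}
    (e : f.comp g h = f.comp g' h') : g = g' := by
  obtain ⟨p, q, a⟩ := f
  obtain ⟨q₁, r, c⟩ := g
  obtain ⟨q₂, r', c'⟩ := g'
  obtain rfl : q = q₁ := h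
  obtain rfl : q = q₂ := h'
  simp only [comp, eqToHom_refl, Category.id_comp, Arr.mk.injEq, true_and] at e
  obtain ⟨rfl, hm⟩ := e
  rw [(cancel_epi a).1 (eq_of_heq hm)]

theorem comp_right_cancel {f f' g : Arr G} {h : f.tgt = g.src} {h' : f'.tgt = g.src}
    (e : f.comp g h = f'.comp g h') : f = f' := by
  obtain ⟨p, q, a⟩ := f
  obtain ⟨p', q', a'⟩ := f'
  obtain ⟨q₁, r, c⟩ := g
  obtain rfl : q = q₁ := h
  obtain rfl : q' = q := h'
  simp only [comp, eqToHom_refl, Category.id_comp, Arr.mk.injEq, true_and] at e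
  obtain ⟨rfl, hm⟩ := e
  rw [(cancel_mono c).1 (eq_of_heq hm)]

@[simp] theorem inv_inv (f : Arr G) : f.inv.inv = f := by
  simp [inv]

/-- Congruence for `comp`, whose composability proof blocks rewriting in the factors. -/
theorem comp_congr {f f' g g' : Arr G} (hf : f = f') (hg : g = g') (h : f.tgt = g.src) :
    f.comp g h = f'.comp g' (hf ▸ hg ▸ h) := by
  subst hf hg
  rfl

theorem eq_inv_of_comp_eq_one {f g : Arr G} {p : P} {h : f.tgt = g.src}
    (e : f.comp g h = one G p) : g = f.inv := by
  have hp : f.src = p := congrArg Arr.src e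
  exact comp_left_cancel (e.trans (hp ▸ (comp_inv f).symm))

theorem eq_inv_of_comp_eq_one' {f g : Arr G} {p : P} {h : f.tgt = g.src}
    (e : f.comp g h = one G p) : f = g.inv := by
  have hp : g.tgt = p := congrArg Arr.tgt e
  exact comp_right_cancel (e.trans (hp ▸ (inv_comp g).symm))

theorem comp_inv_rev (f g : Arr G) (h : f.tgt = g.src) :
    (f.comp g h).inv = g.inv.comp f.inv h.symm := by
  obtain ⟨p, q, a⟩ := f
  obtain ⟨q', r, c⟩ := g
  obtain rfl : q = q' := h
  simp [comp, inv]

/-- A commutative square `x a = b y`, read along its other diagonal: `y a⁻¹ = b⁻¹ x`. -/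
theorem comp_inv_eq_inv_comp {x a b y : Arr G} {h : x.tgt = a.src} {h' : b.tgt = y.src}
    (e : x.comp a h = b.comp y h') (h1 : y.tgt = a.tgt) (h2 : b.src = x.src) :
    y.comp a.inv h1 = b.inv.comp x h2 := by
  obtain ⟨p, q, f⟩ := x
  obtain ⟨q₁, r, g⟩ := a
  obtain ⟨p', q', f'⟩ := b
  obtain ⟨q₂, r', g'⟩ := y
  obtain rfl : q = q₁ := h
  obtain rfl : q' = q₂ := h'
  obtain rfl : r' = r := h1
  obtain rfl : p' = p := h2
  simp only [comp, eqToHom_refl, Category.id_comp, Arr.mk.injEq, true_and, heq_eq_eq] at e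
  simp only [comp, inv, eqToHom_refl, Category.id_comp, Arr.mk.injEq, true_and, heq_eq_eq,
    Groupoid.inv_eq_inv]
  rw [IsIso.comp_inv_eq, Category.assoc, e, IsIso.inv_hom_id_assoc]

end Arr

/-- Pairs `(f, g)` of composable arrows. -/
abbrev CompPair {P : Type u} (V : Groupoid.{v} P) : Type _ :=
  {p : Arr V × Arr V // p.1.tgt = p.2.src}

/-- The product `f g` of a composable pair `(f, g)`. -/
def CompPair.prod {P : Type u} {V : Groupoid.{v} P} (p : CompPair V) : Arr V :=
  p.1.1.comp p.1.2 p.2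

@[simp] theorem CompPair.prod_src {P : Type u} {V : Groupoid.{v} P} (p : CompPair V) :
    p.prod.src = p.1.1.src := rfl

@[simp] theorem CompPair.prod_tgt {P : Type u} {V : Groupoid.{v} P} (p : CompPair V) :
    p.prod.tgt = p.1.2.tgt := rfl

theorem CompPair.ext_fst {P : Type u} {V : Groupoid.{v} P} {p q : CompPair V}
    (h : p.prod = q.prod) (h1 : p.1.1 = q.1.1) : p = q := by
  obtain ⟨⟨f, g⟩, hp⟩ := p
  obtain ⟨⟨f', g'⟩, hq⟩ := q
  obtain rfl : f = f' := h1
  obtain rfl : g = g' := Arr.comp_left_cancel h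
  rfl

theorem CompPair.ext_snd {P : Type u} {V : Groupoid.{v} P} {p q : CompPair V}
    (h : p.prod = q.prod) (h1 : p.1.2 = q.1.2) : p = q := by
  obtain ⟨⟨f, g⟩, hp⟩ := p
  obtain ⟨⟨f', g'⟩, hq⟩ := q
  obtain rfl : g = g' := h1
  obtain rfl : f = f' := Arr.comp_right_cancel h
  rfl

/-! ### Cells as squares -/

namespace Cell

variable {P : Type u} {V : Groupoid.{v} P} {H : Groupoid.{w} P} {M : MatchedPair V H}

/-- With right edge `ver`, top edge `hor`, left edge `left` and bottom edge `bot`, the axiom for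
`x ▷ f g` says that left edges multiply under vertical composition. -/
theorem left_vcomp (A B : Cell M) (h : A.bot = B.hor) :
    (A.vcomp B h).left = A.left.comp B.left
      (A.left_tgt.trans ((congrArg Arr.src h).trans B.left_src.symm)) := by
  obtain ⟨x, g, e⟩ := A
  obtain ⟨y, f, e'⟩ := B
  change M.right x g e = y at h
  subst h
  exact M.left_comp _ _ _ _ _

/-- The axiom for `x y ◁ g` says that bottom edges multiply under horizontal composition. -/
theorem bot_hcomp (A B : Cell M) (h : A.ver = B.left) :
    (A.hcomp B h).bot = A.bot.comp B.bot
      (A.bot_tgt.trans ((congrArg Arr.tgt h).trans B.left_tgt)) := by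
  obtain ⟨x, g, e⟩ := A
  obtain ⟨y, f, e'⟩ := B
  change g = M.left y f e' at h
  subst h
  exact M.comp_right _ _ _ _ _

/-- The rotation identity for a cell with edges top `t`, right `r`, left `l`, bottom `b`:
`t κ(r) = κ(l) b`. -/
theorem rotate (κ : Rotation M) (A : Cell M) :
    A.hor.comp (κ.map A.ver) (A.eq.trans (κ.map_src _).symm) =
      (κ.map A.left).comp A.bot ((κ.map_tgt _).trans A.left_tgt) :=
  κ.rotate _ _ _

theorem left_idV (x : Arr H) : (idV M x).left = Arr.one V x.src := by
  have e : (idV M x).vcomp (idV M x) (bot_idV x) = idV M x := by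
    ext1
    · rfl
    · exact Arr.one_comp _ _ _
  have h := (left_vcomp (idV M x) (idV M x) (bot_idV x)).symm.trans (congrArg left e)
  have h2 := Arr.eq_one_of_comp_eq _ _ _ h
  rwa [left_src] at h2

/-- The inverse of a cell for the horizontal composition. -/
def hinv (A : Cell M) : Cell M := ⟨A.hor.inv, A.left, A.left_src.symm⟩

/-- The inverse of a cell for the vertical composition. -/
def vinv (A : Cell M) : Cell M := ⟨A.bot, A.ver.inv, A.bot_tgt⟩

theorem left_hinv (A : Cell M) : A.hinv.left = A.ver := by
  obtain ⟨x, g, e⟩ := A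
  have hz : ∀ (z : Arr H) (e : z.tgt = g.src), z = Arr.one H g.src → M.left z g e = g := by
    rintro _ _ rfl
    exact M.one_left g
  exact (M.left_left _ _ _ _ _).trans (hz _ _ ((Arr.inv_comp x).trans (by rw [e])))

theorem hinv_hcomp (A : Cell M) : A.hinv.hcomp A rfl = idH M A.ver := by
  ext1
  · exact (Arr.inv_comp _).trans (by rw [A.eq]; rfl)
  · rfl

theorem hcomp_hinv (A : Cell M) : A.hcomp A.hinv A.left_hinv.symm = idH M A.left := by
  ext1
  · exact (Arr.comp_inv _).trans (by rw [← A.left_src]; rfl)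
  · rfl

theorem bot_hinv (A : Cell M) : A.hinv.bot = A.bot.inv :=
  Arr.eq_inv_of_comp_eq_one'
    ((bot_hcomp _ _ _).symm.trans ((congrArg bot A.hinv_hcomp).trans (bot_idH _)))

theorem bot_vinv (A : Cell M) : A.vinv.bot = A.hor := by
  obtain ⟨x, g, e⟩ := A
  have hz : ∀ (z : Arr V) (e : x.tgt = z.src), z = Arr.one V x.tgt → M.right x z e = x := by
    rintro _ _ rfl
    exact M.right_one x
  exact (M.right_right _ _ _ _ _).trans (hz _ _ ((Arr.comp_inv g).trans (by rw [e])))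

theorem vcomp_vinv (A : Cell M) : A.vcomp A.vinv rfl = idV M A.hor := by
  ext1
  · rfl
  · exact (Arr.comp_inv _).trans (by rw [← A.eq]; rfl)

theorem left_vinv (A : Cell M) : A.vinv.left = A.left.inv :=
  Arr.eq_inv_of_comp_eq_one
    ((left_vcomp _ _ _).symm.trans ((congrArg left A.vcomp_vinv).trans (left_idV _)))

/-- The cell used by the antipode is inverted in both directions. -/
theorem vinv_hinv (A : Cell M) : A.hinv.vinv = A.inv := by
  ext1
  · exact A.bot_hinv
  · rfl

theorem left_inv (A : Cell M) : A.inv.left = A.ver.inv := by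
  rw [← vinv_hinv, left_vinv, left_hinv]

/-- A cell is determined by its right and bottom edges. -/
theorem ext_bot {A B : Cell M} (hv : A.ver = B.ver) (hb : A.bot = B.bot) : A = B := by
  have h : A.vinv = B.vinv := by
    ext1
    · exact hb
    · exact congrArg Arr.inv hv
  ext1
  · rw [← A.bot_vinv, h, bot_vinv]
  · exact hv

/-- A cell is determined by its left and top edges. -/
theorem ext_left {A B : Cell M} (hl : A.left = B.left) (ht : A.hor = B.hor) : A = B := by
  have h : A.hinv = B.hinv := by
    ext1
    · exact congrArg Arr.inv ht
    · exact hl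
  ext1
  · exact ht
  · rw [← A.left_hinv, h, left_hinv]

/-- The upper half of a cell cut along a factorization of its right edge. -/
def upper (A : Cell M) (p : CompPair V) (h : p.prod = A.ver) : Cell M :=
  ⟨A.hor, p.1.1, A.eq.trans (congrArg Arr.src h).symm⟩

/-- The lower half of a cell cut along a factorization of its right edge. -/
def lower (A : Cell M) (p : CompPair V) (h : p.prod = A.ver) : Cell M :=
  ⟨(A.upper p h).bot, p.1.2, (A.upper p h).bot_tgt.trans p.2⟩

theorem upper_vcomp_lower (A : Cell M) (p : CompPair V) (h : p.prod = A.ver) :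
    (A.upper p h).vcomp (A.lower p h) rfl = A := by
  ext1
  · rfl
  · exact h

theorem bot_lower (A : Cell M) (p : CompPair V) (h : p.prod = A.ver) :
    (A.lower p h).bot = A.bot :=
  (bot_vcomp _ _ _).symm.trans (congrArg bot (A.upper_vcomp_lower p h))

/-- The factorization of the left edge of a cell induced by one of its right edge. -/
def leftPair (A : Cell M) (p : CompPair V) (h : p.prod = A.ver) : CompPair V :=
  ⟨((A.upper p h).left, (A.lower p h).left),
    (A.upper p h).left_tgt.trans (A.lower p h).left_src.symm⟩

theorem prod_leftPair (A : Cell M) (p : CompPair V) (h : p.prod = A.ver) :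
    (A.leftPair p h).prod = A.left :=
  (left_vcomp _ _ _).symm.trans (congrArg left (A.upper_vcomp_lower p h))

theorem leftPair_injective (A : Cell M) {p q : CompPair V} (hp : p.prod = A.ver)
    (hq : q.prod = A.ver) (h : A.leftPair p hp = A.leftPair q hq) : p = q := by
  have h1 : (A.upper p hp).left = (A.upper q hq).left := congrArg (fun r => r.1.1) h
  exact CompPair.ext_fst (hp.trans hq.symm) (congrArg ver (ext_left h1 rfl))

/-- Every factorization of the left edge is induced by one of the right edge. -/
theorem exists_leftPair_eq (A : Cell M) (q : CompPair V) (hq : q.prod = A.left) :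
    ∃ (p : CompPair V) (hp : p.prod = A.ver), A.leftPair p hp = q := by
  have hp : (A.hinv.leftPair q hq).prod = A.ver := (prod_leftPair _ _ _).trans A.left_hinv
  refine ⟨A.hinv.leftPair q hq, hp, CompPair.ext_fst ((prod_leftPair _ _ _).trans hq.symm) ?_⟩
  have e : A.upper (A.hinv.leftPair q hq) hp = (A.hinv.upper q hq).hinv := by
    ext1
    · exact (Arr.inv_inv _).symm
    · rfl
  exact (congrArg left e).trans (left_hinv _)

/-- The interchange law, for the upper halves. -/
theorem upper_hcomp (A B : Cell M) (h : A.ver = B.left) (p : CompPair V) (hp : p.prod = B.ver) :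
    (A.hcomp B h).upper p hp =
      (A.upper (B.leftPair p hp) ((prod_leftPair _ _ _).trans h.symm)).hcomp (B.upper p hp) rfl :=
  rfl

/-- The interchange law, for the lower halves. -/
theorem lower_hcomp (A B : Cell M) (h : A.ver = B.left) (p : CompPair V) (hp : p.prod = B.ver) :
    (A.hcomp B h).lower p hp =
      (A.lower (B.leftPair p hp) ((prod_leftPair _ _ _).trans h.symm)).hcomp (B.lower p hp) rfl := by
  ext1
  · exact bot_hcomp (A.upper (B.leftPair p hp) ((prod_leftPair _ _ _).trans h.symm))
      (B.upper p hp) rfl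
  · rfl

/-- The ways to write a cell as a vertical composition are its cuts `(upper, lower)`. -/
theorem isVComp_iff (A B C : Cell M) : IsVComp A B C ↔
    ∃ (p : CompPair V) (h : p.prod = C.ver), C.upper p h = A ∧ C.lower p h = B := by
  constructor
  · rintro ⟨h, rfl⟩
    refine ⟨⟨(A.ver, B.ver), A.bot_tgt.symm.trans ((congrArg Arr.tgt h).trans B.eq)⟩, rfl, rfl, ?_⟩
    ext1
    · exact h
    · rfl
  · rintro ⟨p, h, rfl, rfl⟩
    exact ⟨rfl, upper_vcomp_lower _ _ _⟩

/-- Factorizations of the right edge of a cell correspond to factorizations of its left edge. -/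
noncomputable def splitEquiv (A : Cell M) :
    {p : CompPair V // p.prod = A.ver} ≃ {p : CompPair V // p.prod = A.left} :=
  Equiv.ofBijective (fun p => ⟨A.leftPair p.1 p.2, A.prod_leftPair p.1 p.2⟩)
    ⟨fun _ _ h => Subtype.ext (A.leftPair_injective _ _ (congrArg Subtype.val h)), fun q => by
      obtain ⟨p, hp, h⟩ := A.exists_leftPair_eq q.1 q.2
      exact ⟨⟨p, hp⟩, Subtype.ext h⟩⟩

theorem eq_idV_of_ver {A : Cell M} {p : P} (h : A.ver = Arr.one V p) : A = idV M A.hor := by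
  ext1
  · rfl
  · rw [h]
    exact congrArg (Arr.one V) ((congrArg Arr.src h).symm.trans A.eq.symm)

theorem eq_idV_of_left {A : Cell M} {p : P} (h : A.left = Arr.one V p) : A = idV M A.hor := by
  have e : A.hinv = idV M A.hinv.hor := eq_idV_of_ver h
  refine eq_idV_of_ver (p := A.hinv.hor.src) ?_
  rw [← A.left_hinv, e]
  exact left_idV _

end Cell

/-! ### Sums over composable pairs -/

section Sums

variable {P : Type u} {V : Groupoid.{v} P} [Fintype (Arr V)] {E : Type*} [AddCommMonoid E]

open scoped Classical

theorem sum_compPair_fst (g : Arr V) (F : Arr V → E) :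
    (∑ p : CompPair V, if p.1.1 = g then F p.1.2 else 0) =
      ∑ f : Arr V, if f.src = g.tgt then F f else 0 := by
  rw [← Finset.sum_filter, ← Finset.sum_filter]
  refine Finset.sum_bij (fun p _ => p.1.2) ?_ ?_ ?_ ?_
  · intro p hp
    simp only [Finset.mem_filter, Finset.mem_univ, true_and] at hp ⊢
    rw [← hp, p.2]
  · intro p hp q hq h
    simp only [Finset.mem_filter, Finset.mem_univ, true_and] at hp hq
    exact Subtype.ext (Prod.ext (hp.trans hq.symm) h)
  · intro f hf
    simp only [Finset.mem_filter, Finset.mem_univ, true_and] at hf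
    exact ⟨⟨(g, f), hf.symm⟩, by simp, rfl⟩
  · exact fun _ _ => rfl

theorem sum_compPair_snd (g : Arr V) (F : Arr V → E) :
    (∑ p : CompPair V, if p.1.2 = g then F p.1.1 else 0) =
      ∑ f : Arr V, if f.tgt = g.src then F f else 0 := by
  rw [← Finset.sum_filter, ← Finset.sum_filter]
  refine Finset.sum_bij (fun p _ => p.1.1) ?_ ?_ ?_ ?_
  · intro p hp
    simp only [Finset.mem_filter, Finset.mem_univ, true_and] at hp ⊢
    rw [← hp, p.2]
  · intro p hp q hq h
    simp only [Finset.mem_filter, Finset.mem_univ, true_and] at hp hq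
    exact Subtype.ext (Prod.ext h (hp.trans hq.symm))
  · intro f hf
    simp only [Finset.mem_filter, Finset.mem_univ, true_and] at hf
    exact ⟨⟨(f, g), hf⟩, by simp, rfl⟩
  · exact fun _ _ => rfl

theorem sum_split_one_fst (a : P) (F : Arr V → E) :
    (∑ p : {p : CompPair V // p.prod = Arr.one V a}, F p.1.1.1) =
      ∑ f : Arr V, if f.src = a then F f else 0 := by
  rw [← Finset.sum_filter]
  refine Finset.sum_bij (fun p _ => p.1.1.1) ?_ ?_ ?_ ?_
  · intro p _
    simpa using congrArg Arr.src p.2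
  · intro p _ q _ h
    exact Subtype.ext (CompPair.ext_fst (p.2.trans q.2.symm) h)
  · intro f hf
    simp only [Finset.mem_filter, Finset.mem_univ, true_and] at hf
    subst hf
    exact ⟨⟨⟨(f, f.inv), rfl⟩, f.comp_inv⟩, Finset.mem_univ _, rfl⟩
  · exact fun _ _ => rfl

theorem sum_split_one_snd (a : P) (F : Arr V → E) :
    (∑ p : {p : CompPair V // p.prod = Arr.one V a}, F p.1.1.2) =
      ∑ f : Arr V, if f.tgt = a then F f else 0 := by
  rw [← Finset.sum_filter]
  refine Finset.sum_bij (fun p _ => p.1.1.2) ?_ ?_ ?_ ?_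
  · intro p _
    simpa using congrArg Arr.tgt p.2
  · intro p _ q _ h
    exact Subtype.ext (CompPair.ext_snd (p.2.trans q.2.symm) h)
  · intro f hf
    simp only [Finset.mem_filter, Finset.mem_univ, true_and] at hf
    subst hf
    exact ⟨⟨⟨(f.inv, f), rfl⟩, f.inv_comp⟩, Finset.mem_univ _, rfl⟩
  · exact fun _ _ => rfl

end Sums

/-! ### Products and coproducts of cells -/

namespace CellAlg

variable {k : Type*} [Field k] {P : Type u} {V : Groupoid.{v} P} {H : Groupoid.{w} P}
  {M : MatchedPair V H}

/-- A property stable under linear combinations holds for all elements if it holds for cells. -/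
theorem induction {p : CellAlg k M → Prop} (hof : ∀ A, p (of k A))
    (hadd : ∀ a b, p a → p b → p (a + b)) (hsmul : ∀ (c : k) a, p a → p (c • a)) (hz : p 0)
    (a : CellAlg k M) : p a := by
  refine Finsupp.induction_linear a hz hadd fun A c => ?_
  have h : (Finsupp.single A c : Cell M →₀ k) = c • Finsupp.single A (1 : k) :=
    (Finsupp.smul_single_one A c).symm
  exact h ▸ hsmul c _ (hof A)

theorem of_mul_of_pos {A B : Cell M} (h : A.ver = B.left) :
    of k A * of k B = of k (A.hcomp B h) := by
  rw [of_mul_of, cellMul, dif_pos h]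

theorem of_mul_of_neg {A B : Cell M} (h : A.ver ≠ B.left) : of k A * of k B = 0 := by
  rw [of_mul_of, cellMul, dif_neg h]

open scoped Classical in
theorem of_mul_idH (A : Cell M) (g : Arr V) :
    of k A * of k (Cell.idH M g) = if g = A.ver then of k A else 0 := by
  split_ifs with h
  · subst h
    rw [of_mul_of_pos (Cell.left_idH _).symm, Cell.hcomp_idH]
  · exact of_mul_of_neg fun e => h (e.trans (Cell.left_idH g)).symm

open scoped Classical in
theorem idH_mul_of (A : Cell M) (g : Arr V) :
    of k (Cell.idH M g) * of k A = if g = A.left then of k A else 0 := by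
  split_ifs with h
  · rw [of_mul_of_pos (show (Cell.idH M g).ver = _ from h), Cell.idH_hcomp _ _ h]
  · exact of_mul_of_neg h

open scoped Classical in
theorem idH_mul_idH (g g' : Arr V) :
    of k (Cell.idH M g) * of k (Cell.idH M g') = if g = g' then of k (Cell.idH M g') else 0 := by
  rw [idH_mul_of, Cell.left_idH]

variable [Fintype (Arr V)] [Fintype (Arr H)]

open scoped Classical

/-- The comultiplication cuts a cell along all factorizations of its right edge. -/
theorem comul_of_eq_sum (A : Cell M) : Coalgebra.comul (R := k) (of k A) =
    ∑ p : {p : CompPair V // p.prod = A.ver},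
      of k (A.upper p.1 p.2) ⊗ₜ[k] of k (A.lower p.1 p.2) := by
  rw [comul_of, ← Fintype.sum_prod_type']
  symm
  refine Fintype.sum_of_injective (fun p => (A.upper p.1 p.2, A.lower p.1 p.2)) ?_ _ _ ?_ ?_
  · intro p q h
    exact Subtype.ext (CompPair.ext_fst (p.2.trans q.2.symm) (congrArg (fun r => r.1.ver) h))
  · rintro ⟨B, C⟩ h
    refine if_neg fun h' => h ?_
    obtain ⟨p, hp, rfl, rfl⟩ := (Cell.isVComp_iff _ _ _).1 h'
    exact ⟨⟨p, hp⟩, rfl⟩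
  · intro p
    rw [if_pos ⟨rfl, Cell.upper_vcomp_lower _ _ _⟩]

theorem comul_idH (g : Arr V) : Coalgebra.comul (R := k) (of k (Cell.idH M g)) =
    ∑ p : CompPair V, if p.prod = g then
      of k (Cell.idH M p.1.1) ⊗ₜ[k] of k (Cell.idH M p.1.2) else 0 := by
  rw [comul_of_eq_sum, ← Finset.sum_filter,
    Finset.sum_subtype (p := fun p : CompPair V => p.prod = g) _ (by simp)]
 
  refine Finset.sum_congr rfl fun p _ => ?_
  have h1 : (Cell.idH M g).upper p.1 p.2 = Cell.idH M p.1.1.1 := by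
    ext1
    · exact congrArg (Arr.one H) (congrArg Arr.src p.2).symm
    · rfl
  have h2 : (Cell.idH M g).lower p.1 p.2 = Cell.idH M p.1.1.2 := by
    ext1
    · exact (congrArg Cell.bot h1).trans ((Cell.bot_idH _).trans (congrArg (Arr.one H) p.1.2))
    · rfl
  rw [h1, h2]

/-- `Δ(1)` is the indicator of the composable pairs of vertical arrows. -/
theorem comul_one_eq_sum : Coalgebra.comul (R := k) (1 : CellAlg k M) =
    ∑ p : CompPair V, of k (Cell.idH M p.1.1) ⊗ₜ[k] of k (Cell.idH M p.1.2) := by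
  simp only [one_def, map_sum, comul_idH]
  rw [Finset.sum_comm]
  simp

/-! ### The weak bialgebra axioms -/

/-- Multiplicativity of `Δ` on cells is the interchange law: a cut of `B` determines the only cut of
`A` that composes horizontally with it. -/
theorem comul_mul_of (A B : Cell M) : Coalgebra.comul (R := k) (of k A * of k B) =
    Coalgebra.comul (R := k) (of k A) * Coalgebra.comul (R := k) (of k B) := by
  rw [comul_of_eq_sum A, comul_of_eq_sum B, Finset.sum_mul_sum, Finset.sum_comm]
  simp only [Algebra.TensorProduct.tmul_mul_tmul]
  by_cases h : A.ver = B.left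
  · rw [of_mul_of_pos h, comul_of_eq_sum]
    refine Finset.sum_congr rfl fun p _ => ?_
    rw [Finset.sum_eq_single ⟨B.leftPair p.1 p.2, (B.prod_leftPair _ _).trans h.symm⟩]
    · rw [Cell.upper_hcomp A B h p.1 p.2, Cell.lower_hcomp A B h p.1 p.2]
      exact (congrArg₂ _ (of_mul_of_pos _) (of_mul_of_pos _)).symm
    · intro q _ hq
      rw [of_mul_of_neg, zero_tmul]
      intro e
      exact hq (Subtype.ext (CompPair.ext_fst
        (q.2.trans (h.trans (B.prod_leftPair _ _).symm)) e))
    · intro h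
      exact absurd (Finset.mem_univ _) h
  · rw [of_mul_of_neg h, map_zero]
    refine (Finset.sum_eq_zero fun p _ => Finset.sum_eq_zero fun q _ => ?_).symm
    by_cases h1 : (A.upper q.1 q.2).ver = (B.upper p.1 p.2).left
    · rw [of_mul_of_neg (A := A.lower q.1 q.2), tmul_zero]
      intro h2
      refine h (q.2.symm.trans (Eq.trans ?_ (B.prod_leftPair p.1 p.2)))
      exact congrArg CompPair.prod
        (Subtype.ext (Prod.ext h1 h2) : q.1 = B.leftPair p.1 p.2)
    · rw [of_mul_of_neg h1, zero_tmul]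

theorem comul_mul (a b : CellAlg k M) : Coalgebra.comul (R := k) (a * b) =
    Coalgebra.comul (R := k) a * Coalgebra.comul (R := k) b := by
  induction a using induction with
  | hof A =>
    induction b using induction with
    | hof B => exact comul_mul_of A B
    | hadd a b ha hb => simp only [mul_add, map_add, ha, hb]
    | hsmul c a ha => simp only [mul_smul_comm, map_smul, ha]
    | hz => simp only [mul_zero, map_zero]
  | hadd a b ha hb => simp only [add_mul, map_add, ha, hb]
  | hsmul c a ha => simp only [smul_mul_assoc, map_smul, ha]
  | hz => simp only [zero_mul, map_zero]

omit [Fintype (Arr H)] in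
/-- `Finset.sum_mul_sum` with the instances on the triple tensor product fixed; as a `simp` lemma the
general version does not unify there. -/
theorem sum_mul_sum {ι κ : Type*} [Fintype ι] [Fintype κ]
    (f : ι → CellAlg k M ⊗[k] (CellAlg k M ⊗[k] CellAlg k M))
    (g : κ → CellAlg k M ⊗[k] (CellAlg k M ⊗[k] CellAlg k M)) :
    (∑ i, f i) * ∑ j, g j = ∑ i, ∑ j, f i * g j := by
  exact Finset.sum_mul_sum (R := CellAlg k M ⊗[k] (CellAlg k M ⊗[k] CellAlg k M)) _ _ _ _

/-- `(id ⊗ Δ)Δ(1)` is the sum over composable triples; a triple is a pair `q` together with an arrow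
`f` ending at its source. -/
theorem lTensor_comul_comul_one :
    (Coalgebra.comul (R := k)).lTensor (CellAlg k M) (Coalgebra.comul (R := k) (1 : CellAlg k M)) =
      ∑ q : CompPair V, ∑ f : Arr V, if f.tgt = q.1.1.src then
        of k (Cell.idH M f) ⊗ₜ[k]
          (of k (Cell.idH M q.1.1) ⊗ₜ[k] of k (Cell.idH M q.1.2)) else 0 := by
  simp only [comul_one_eq_sum, map_sum, LinearMap.lTensor_tmul, comul_idH, tmul_sum]
  rw [Finset.sum_comm]
  refine Finset.sum_congr rfl fun q _ => ?_
  refine Eq.trans (Finset.sum_congr rfl fun p _ => ?_) (sum_compPair_snd q.prod _)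
  by_cases h : q.prod = p.1.2
  · rw [if_pos h, if_pos h.symm]
  · rw [if_neg h, if_neg (Ne.symm h), tmul_zero]

theorem comul_one_mul : TensorProduct.assoc k _ _ _
      (Coalgebra.comul (R := k) (1 : CellAlg k M) ⊗ₜ[k] (1 : CellAlg k M)) *
      ((1 : CellAlg k M) ⊗ₜ[k] Coalgebra.comul (R := k) (1 : CellAlg k M)) =
    (Coalgebra.comul (R := k)).lTensor _ (Coalgebra.comul (R := k) (1 : CellAlg k M)) := by
  rw [lTensor_comul_comul_one]
  simp only [comul_one_eq_sum, map_sum, tmul_sum, sum_tmul, TensorProduct.assoc_tmul,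
    sum_mul_sum, Algebra.TensorProduct.tmul_mul_tmul, mul_one, one_mul, idH_mul_idH]
  rw [Finset.sum_comm]
  refine Finset.sum_congr rfl fun q _ => ?_
  refine Eq.trans (Finset.sum_congr rfl fun p _ => ?_) (sum_compPair_snd q.1.1 _)
  by_cases h : p.1.2 = q.1.1
  · rw [if_pos h, if_pos h]
  · rw [if_neg h, if_neg h, zero_tmul, tmul_zero]

theorem mul_comul_one : ((1 : CellAlg k M) ⊗ₜ[k] Coalgebra.comul (R := k) (1 : CellAlg k M)) *
      TensorProduct.assoc k _ _ _
        (Coalgebra.comul (R := k) (1 : CellAlg k M) ⊗ₜ[k] (1 : CellAlg k M)) =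
    (Coalgebra.comul (R := k)).lTensor _ (Coalgebra.comul (R := k) (1 : CellAlg k M)) := by
  rw [lTensor_comul_comul_one]
  simp only [comul_one_eq_sum, map_sum, tmul_sum, sum_tmul, TensorProduct.assoc_tmul,
    sum_mul_sum, Algebra.TensorProduct.tmul_mul_tmul, mul_one, one_mul, idH_mul_idH]
  refine Finset.sum_congr rfl fun q _ => ?_
  refine Eq.trans (Finset.sum_congr rfl fun p _ => ?_) (sum_compPair_snd q.1.1 _)
  by_cases h : p.1.2 = q.1.1
  · rw [if_pos h.symm, if_pos h, h]
  · rw [if_neg (Ne.symm h), if_neg h, zero_tmul, tmul_zero]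

theorem counit_of_eq (A : Cell M) : Coalgebra.counit (R := k) (of k A) =
    if ∃ p, A.ver = Arr.one V p then (1 : k) else 0 := by
  rw [counit_of]
  refine if_congr ⟨?_, ?_⟩ rfl rfl
  · rintro ⟨x, rfl⟩
    exact ⟨_, rfl⟩
  · rintro ⟨p, h⟩
    exact ⟨_, Cell.eq_idV_of_ver h⟩

theorem counit_of_mul_of (A B : Cell M) : Coalgebra.counit (R := k) (of k A * of k B) =
    if A.ver = B.left ∧ ∃ p, B.ver = Arr.one V p then (1 : k) else 0 := by
  by_cases h : A.ver = B.left
  · rw [of_mul_of_pos h, counit_of_eq]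
    exact if_congr ⟨fun h' => ⟨h, h'⟩, fun h' => h'.2⟩ rfl rfl
  · rw [of_mul_of_neg h, map_zero, if_neg fun h' => h h'.1]

/-- The common value of both counit axioms: in `∑ ε(a b₁) ε(b₂ c)` and `∑ ε(a b₂) ε(b₁ c)` only the
cut with one trivial half contributes. -/
theorem counit_of_mul_of_mul_of (A B C : Cell M) :
    Coalgebra.counit (R := k) (of k A * of k (Cell.idV M B.hor)) *
      Coalgebra.counit (R := k) (of k B * of k C) =
    Coalgebra.counit (R := k) (of k A * of k B * of k C) := by
  rw [mul_assoc, counit_of_mul_of B C, counit_of_mul_of A]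
  by_cases h : B.ver = C.left
  · rw [of_mul_of_pos h, counit_of_mul_of]
    by_cases h' : ∃ p, C.ver = Arr.one V p
    · obtain ⟨p, hp⟩ := h'
      have hB : B.ver = Arr.one V C.hor.src := by
        rw [h, Cell.eq_idV_of_ver hp]
        exact Cell.left_idV _
      rw [if_pos (⟨h, p, hp⟩ : B.ver = C.left ∧ _), mul_one, ← Cell.eq_idV_of_ver hB,
        Cell.left_hcomp]
      exact if_congr (and_congr_right fun _ => ⟨fun _ => ⟨p, hp⟩, fun _ => ⟨_, hB⟩⟩) rfl rfl
    · rw [if_neg (fun h'' => h' h''.2 : ¬ (B.ver = C.left ∧ _)), mul_zero]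
      exact (if_neg fun h'' => h' h''.2).symm
  · rw [of_mul_of_neg h, if_neg (fun h'' => h h''.1 : ¬ (B.ver = C.left ∧ _)), mul_zero, mul_zero,
      map_zero]

/-- Only the cut with trivial upper half contributes. -/
theorem counit_mul_counit_of (A B C : Cell M) :
    (∑ p : {p : CompPair V // p.prod = B.ver},
      Coalgebra.counit (R := k) (of k A * of k (B.upper p.1 p.2)) *
        Coalgebra.counit (R := k) (of k (B.lower p.1 p.2) * of k C)) =
    Coalgebra.counit (R := k) (of k A * of k B * of k C) := by
  rw [← counit_of_mul_of_mul_of, Finset.sum_eq_single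
    ⟨⟨(Arr.one V B.ver.src, B.ver), rfl⟩, Arr.one_comp _ _ _⟩]
  · congr 3
    · congr 1
      ext1
      · rfl
      · exact congrArg (Arr.one V) B.eq.symm
    · congr 1
      ext1
      · refine Eq.trans (congrArg Cell.bot (Cell.eq_idV_of_ver (p := B.ver.src) rfl)) ?_
        exact Cell.bot_idV _
      · rfl
  · intro p _ hp
    rw [counit_of_mul_of, if_neg, zero_mul]
    rintro ⟨-, a, ha⟩
    refine hp (Subtype.ext (CompPair.ext_fst (p.2.trans (Arr.one_comp _ _ _).symm) ?_))
    have e : p.1.prod.src = B.ver.src := congrArg Arr.src p.2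
    exact ha.trans (congrArg (Arr.one V) ((congrArg Arr.src ha).symm.trans e))
  · intro h
    exact absurd (Finset.mem_univ _) h

/-- Only the cut with trivial lower half contributes. -/
theorem counit_mul_counit_of' (A B C : Cell M) :
    (∑ p : {p : CompPair V // p.prod = B.ver},
      Coalgebra.counit (R := k) (of k (B.upper p.1 p.2) * of k C) *
        Coalgebra.counit (R := k) (of k A * of k (B.lower p.1 p.2))) =
    Coalgebra.counit (R := k) (of k A * of k B * of k C) := by
  -- A nonzero `ε(A · lower)` makes the right edge of the lower half an identity.
  have hvan : ∀ p : {p : CompPair V // p.prod = B.ver},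
      p.1.1.2 ≠ Arr.one V B.ver.tgt → Coalgebra.counit (R := k)
        (of k A * of k (B.lower p.1 p.2)) = 0 := by
    intro p hp
    rw [counit_of_mul_of, if_neg]
    rintro ⟨-, a, ha⟩
    have e : p.1.prod.tgt = B.ver.tgt := congrArg Arr.tgt p.2
    exact hp (ha.trans (congrArg (Arr.one V) ((congrArg Arr.tgt ha).symm.trans e)))
  have hlow : B.lower ⟨(B.ver, Arr.one V B.ver.tgt), rfl⟩ (Arr.comp_one _ _ _) =
      Cell.idV M B.bot := by
    ext1
    · rfl
    · exact congrArg (Arr.one V) B.bot_tgt.symm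
  rw [Finset.sum_eq_single ⟨⟨(B.ver, Arr.one V B.ver.tgt), rfl⟩, Arr.comp_one _ _ _⟩]
  · rw [hlow, ← counit_of_mul_of_mul_of, mul_comm]
    by_cases h : ∃ p, B.ver = Arr.one V p
    -- The remaining term has `idV M B.bot` in place of `idV M B.hor`, which is the same if `B` is a
    -- vertical identity; otherwise the other factor vanishes.
    · obtain ⟨p, hp⟩ := h
      have hb : B.bot = B.hor :=
        (congrArg Cell.bot (Cell.eq_idV_of_ver hp)).trans (Cell.bot_idV _)
      rw [hb]
      rfl
    · have h0 : Coalgebra.counit (R := k) (of k B * of k C) = 0 := by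
        rw [counit_of_mul_of, if_neg]
        rintro ⟨h1, p, hp⟩
        refine h ⟨C.hor.src, h1.trans ?_⟩
        rw [Cell.eq_idV_of_ver hp]
        exact Cell.left_idV _
      change _ * Coalgebra.counit (R := k) (of k B * of k C) = _
      rw [h0, mul_zero, mul_zero]
  · intro p _ hp
    rw [hvan p, mul_zero]
    exact fun e => hp (Subtype.ext (CompPair.ext_snd (p.2.trans (Arr.comp_one _ _ _).symm) e))
  · intro h
    exact absurd (Finset.mem_univ _) h

theorem counit_mul (a b c : CellAlg k M) :
    LinearMap.mul' k k (TensorProduct.map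
      (Coalgebra.counit (R := k) ∘ₗ LinearMap.mulLeft k a)
      (Coalgebra.counit (R := k) ∘ₗ LinearMap.mulRight k c) (Coalgebra.comul (R := k) b)) =
    Coalgebra.counit (R := k) (a * b * c) := by
  induction b using induction with
  | hof B =>
    simp only [comul_of_eq_sum, map_sum, TensorProduct.map_tmul, LinearMap.comp_apply,
      LinearMap.mul'_apply, LinearMap.mulLeft_apply, LinearMap.mulRight_apply]
    induction a using induction with
    | hof A =>
      induction c using induction with
      | hof C => exact counit_mul_counit_of A B C
      | hadd a b ha hb => simp only [mul_add, map_add, Finset.sum_add_distrib, ha, hb]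
      | hsmul r a ha =>
        simp only [mul_smul_comm, map_smul, ← Finset.smul_sum, ha]
      | hz => simp
    | hadd a b ha hb => simp only [add_mul, map_add, Finset.sum_add_distrib, ha, hb]
    | hsmul r a ha =>
      simp only [smul_mul_assoc, map_smul, ← Finset.smul_sum, ha]
    | hz => simp
  | hadd a b ha hb => simp only [mul_add, add_mul, map_add, ha, hb]
  | hsmul r a ha => simp only [mul_smul_comm, smul_mul_assoc, map_smul, ha]
  | hz => simp

theorem counit_mul' (a b c : CellAlg k M) :
    LinearMap.mul' k k (TensorProduct.map
      (Coalgebra.counit (R := k) ∘ₗ LinearMap.mulRight k c)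
      (Coalgebra.counit (R := k) ∘ₗ LinearMap.mulLeft k a) (Coalgebra.comul (R := k) b)) =
    Coalgebra.counit (R := k) (a * b * c) := by
  induction b using induction with
  | hof B =>
    simp only [comul_of_eq_sum, map_sum, TensorProduct.map_tmul, LinearMap.comp_apply,
      LinearMap.mul'_apply, LinearMap.mulLeft_apply, LinearMap.mulRight_apply]
    induction a using induction with
    | hof A =>
      induction c using induction with
      | hof C => exact counit_mul_counit_of' A B C
      | hadd a b ha hb => simp only [mul_add, add_mul, map_add, Finset.sum_add_distrib, ha, hb]
      | hsmul r a ha =>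
        simp only [mul_smul_comm, smul_mul_assoc, map_smul, ← Finset.smul_sum, ha]
      | hz => simp
    | hadd a b ha hb => simp only [mul_add, add_mul, map_add, Finset.sum_add_distrib, ha, hb]
    | hsmul r a ha =>
      simp only [mul_smul_comm, smul_mul_assoc, map_smul, ← Finset.smul_sum, ha]
    | hz => simp
  | hadd a b ha hb => simp only [mul_add, add_mul, map_add, ha, hb]
  | hsmul r a ha => simp only [mul_smul_comm, smul_mul_assoc, map_smul, ha]
  | hz => simp

variable (k M) in
theorem isWeakBialgebra : IsWeakBialgebra k (CellAlg k M) where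
  comul_mul := comul_mul
  comul_one := comul_one_mul
  comul_one' := mul_comul_one
  counit_mul := counit_mul
  counit_mul' := counit_mul'

/-! ### The antipode -/

theorem sourceMap_of (A : Cell M) : sourceMap k (of k A) =
    if ∃ p, A.ver = Arr.one V p then
      ∑ f : Arr V, if f.tgt = A.hor.tgt then of k (Cell.idH M f) else 0 else 0 := by
  simp only [sourceMap, comul_one_eq_sum, Finset.mul_sum, Algebra.TensorProduct.tmul_mul_tmul,
    one_mul, of_mul_idH, map_sum, LinearMap.lTensor_tmul, TensorProduct.rid_tmul]
  rw [A.eq, ← sum_compPair_snd A.ver]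
  split_ifs with h
  · refine Finset.sum_congr rfl fun p _ => ?_
    split_ifs
    · rw [counit_of_eq, if_pos h, one_smul]
    · rw [map_zero, zero_smul]
  · refine Finset.sum_eq_zero fun p _ => ?_
    split_ifs
    · rw [counit_of_eq, if_neg h, zero_smul]
    · rw [map_zero, zero_smul]

theorem targetMap_of (A : Cell M) : targetMap k (of k A) =
    if ∃ p, A.ver = Arr.one V p then
      ∑ f : Arr V, if f.src = A.hor.src then of k (Cell.idH M f) else 0 else 0 := by
  simp only [targetMap, comul_one_eq_sum, Finset.sum_mul, Algebra.TensorProduct.tmul_mul_tmul,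
    mul_one, idH_mul_of, map_sum, LinearMap.rTensor_tmul, TensorProduct.lid_tmul]
  split_ifs with h
  · have e : A.left.tgt = A.hor.src := by
      obtain ⟨p, hp⟩ := h
      rw [Cell.eq_idV_of_ver hp, Cell.left_idV]
      rfl
    rw [← e, ← sum_compPair_fst A.left]
    refine Finset.sum_congr rfl fun p _ => ?_
    split_ifs
    · rw [counit_of_eq, if_pos h, one_smul]
    · rw [map_zero, zero_smul]
  · refine Finset.sum_eq_zero fun p _ => ?_
    split_ifs
    · rw [counit_of_eq, if_neg h, zero_smul]
    · rw [map_zero, zero_smul]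

omit [Fintype (Arr H)] in
theorem antipode_of (A : Cell M) : antipode k (of k A) = of k A.inv := lift_of _ A

/-- The product `upper⁻¹ · lower` is nonzero only if the left edge of `A`, hence `A` itself, is a
(vertical) identity, and then it is the horizontal identity of the right edge of `lower`. -/
theorem antipode_mul_of (A : Cell M) :
    LinearMap.mul' k _ (TensorProduct.map (antipode k) LinearMap.id
      (Coalgebra.comul (R := k) (of k A))) = sourceMap k (of k A) := by
  simp only [comul_of_eq_sum, map_sum, TensorProduct.map_tmul, LinearMap.mul'_apply, antipode_of,
    LinearMap.id_apply, sourceMap_of]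
  by_cases h : ∃ p, A.ver = Arr.one V p
  · obtain ⟨x, rfl⟩ : ∃ x, A = Cell.idV M x := ⟨_, Cell.eq_idV_of_ver h.choose_spec⟩
    rw [if_pos h]
    refine Eq.trans (Finset.sum_congr rfl fun p _ => ?_)
      (sum_split_one_snd x.tgt fun f => of k (Cell.idH M f))
    have e : ((Cell.idV M x).upper p.1 p.2).inv.ver = ((Cell.idV M x).lower p.1 p.2).left :=
      (Arr.eq_inv_of_comp_eq_one
        (((Cell.idV M x).prod_leftPair p.1 p.2).trans (Cell.left_idV x))).symm
    rw [of_mul_of_pos e]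
    congr 1
    ext1
    · exact (Arr.inv_comp _).trans (congrArg (Arr.one H) ((Cell.idV M x).lower p.1 p.2).eq)
    · rfl
  · rw [if_neg h]
    refine Finset.sum_eq_zero fun p _ => of_mul_of_neg fun e => h ?_
    refine ⟨A.hor.tgt, ?_⟩
    have e' : A.left = Arr.one V A.hor.src := by
      rw [← A.prod_leftPair p.1 p.2]
      refine (Arr.comp_congr rfl e.symm _).trans ((Arr.comp_inv _).trans ?_)
      exact congrArg (Arr.one V) (A.upper p.1 p.2).left_src
    exact congrArg Cell.ver (Cell.eq_idV_of_left e')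

/-- The product `upper · lower⁻¹` is nonzero only if `A` is a vertical identity, and then it is the
horizontal identity of the left edge of `upper`. -/
theorem mul_antipode_of (A : Cell M) :
    LinearMap.mul' k _ (TensorProduct.map LinearMap.id (antipode k)
      (Coalgebra.comul (R := k) (of k A))) = targetMap k (of k A) := by
  simp only [comul_of_eq_sum, map_sum, TensorProduct.map_tmul, LinearMap.mul'_apply, antipode_of,
    LinearMap.id_apply, targetMap_of]
  by_cases h : ∃ p, A.ver = Arr.one V p
  · obtain ⟨x, rfl⟩ : ∃ x, A = Cell.idV M x := ⟨_, Cell.eq_idV_of_ver h.choose_spec⟩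
    rw [if_pos h, show (Cell.idV M x).hor.src = x.src from rfl, ← sum_split_one_fst x.src,
      ← Cell.left_idV (M := M) x, ← (Cell.idV M x).splitEquiv.sum_comp]
    refine Finset.sum_congr rfl fun p _ => ?_
    have e : ((Cell.idV M x).upper p.1 p.2).ver = ((Cell.idV M x).lower p.1 p.2).inv.left := by
      rw [Cell.left_inv]
      exact Arr.eq_inv_of_comp_eq_one' p.2
    rw [of_mul_of_pos e]
    congr 1
    ext1
    · have hb : ((Cell.idV M x).lower p.1 p.2).inv.hor = x.inv :=
        congrArg Arr.inv ((Cell.bot_lower _ _ _).trans (Cell.bot_idV x))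
      refine (Arr.comp_congr rfl hb _).trans ((Arr.comp_inv x).trans ?_)
      exact congrArg (Arr.one H) ((Cell.idV M x).upper p.1 p.2).left_src.symm
    · have h2 := (Cell.idV M x).prod_leftPair p.1 p.2
      have h3 := Arr.eq_inv_of_comp_eq_one' (h2.trans (Cell.left_idV x))
      exact h3.symm
  · rw [if_neg h]
    refine Finset.sum_eq_zero fun p _ => of_mul_of_neg fun e => h ?_
    refine ⟨A.ver.src, ?_⟩
    rw [Cell.left_inv] at e
    rw [← p.2]
    have h4 : p.1.1.1 = p.1.1.2.inv := e
    refine (Arr.comp_congr h4 rfl _).trans ((Arr.inv_comp _).trans ?_)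
    exact congrArg (Arr.one V) (congrArg Arr.src h4).symm

/-- As `h₁ S(h₂)` is the target map, which vanishes off the vertical identities, only the cut of `A`
with trivial lower half contributes. -/
theorem antipode_mul_targetMap_of (A : Cell M) :
    LinearMap.mul' k _ (TensorProduct.map (antipode k)
      (LinearMap.mul' k (CellAlg k M) ∘ₗ TensorProduct.map LinearMap.id (antipode k) ∘ₗ
        Coalgebra.comul (R := k)) (Coalgebra.comul (R := k) (of k A))) = antipode k (of k A) := by
  rw [comul_of_eq_sum]
  simp only [map_sum, TensorProduct.map_tmul, LinearMap.mul'_apply, antipode_of,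
    LinearMap.comp_apply, mul_antipode_of, targetMap_of]
  rw [Finset.sum_eq_single ⟨⟨(A.ver, Arr.one V A.ver.tgt), rfl⟩, Arr.comp_one _ _ _⟩]
  · rw [if_pos ⟨_, rfl⟩, Finset.mul_sum, Finset.sum_eq_single A.left.inv]
    · refine (congrArg (_ * ·) (if_pos A.left_tgt)).trans ?_
      exact (of_mul_idH _ _).trans (if_pos rfl)
    · intro f _ hf
      split_ifs
      · rw [of_mul_idH, if_neg]
        exact hf
      · rw [mul_zero]
    · intro h
      exact absurd (Finset.mem_univ _) h
  · intro p _ hp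
    rw [if_neg, mul_zero]
    rintro ⟨a, ha⟩
    have e : p.1.prod.tgt = A.ver.tgt := congrArg Arr.tgt p.2
    exact hp (Subtype.ext (CompPair.ext_snd (p.2.trans (Arr.comp_one _ _ _).symm)
      (Eq.trans ha (congrArg (Arr.one V) ((congrArg Arr.tgt ha).symm.trans e)))))
  · intro h
    exact absurd (Finset.mem_univ _) h

variable (k M) in
theorem isAntipode : IsAntipode k (antipode k (M := M)) where
  antipode_mul h := by
    induction h using induction with
    | hof A => exact antipode_mul_of A
    | hadd a b ha hb =>
      simp only [sourceMap, map_add, tmul_add, add_mul] at ha hb ⊢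
      rw [ha, hb]
    | hsmul c a ha =>
      simp only [sourceMap, map_smul, tmul_smul, smul_mul_assoc] at ha ⊢
      rw [ha]
    | hz => simp [sourceMap]
  mul_antipode h := by
    induction h using induction with
    | hof A => exact mul_antipode_of A
    | hadd a b ha hb =>
      simp only [targetMap, map_add, add_tmul, mul_add] at ha hb ⊢
      rw [ha, hb]
    | hsmul c a ha =>
      simp only [targetMap, map_smul, ← smul_tmul', mul_smul_comm] at ha ⊢
      rw [ha]
    | hz => simp [targetMap]
  antipode_mul_antipode h := by
    induction h using induction with
    | hof A => exact antipode_mul_targetMap_of A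
    | hadd a b ha hb =>
      simp only [map_add] at ha hb ⊢
      rw [ha, hb]
    | hsmul c a ha =>
      simp only [map_smul] at ha ⊢
      rw [ha]
    | hz => simp

end CellAlg

/-! ### The braiding of composable pairs -/

section Braiding

variable {P : Type u} {V : Groupoid.{v} P} {H : Groupoid.{w} P} {M : MatchedPair V H}

/-- The first tensor factor of the summand of `R` indexed by `p = (g, f)`: the cell with right edge `g`
and bottom edge `ξ(f)⁻¹`. -/
def Rotation.cellX (ξ : Rotation M) (p : CompPair V) : Cell M :=
  ⟨M.right (ξ.map p.1.2).inv p.1.1.inv (ξ.inv_tgt_eq p.2), p.1.1, M.right_tgt _ _ _⟩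

/-- The second tensor factor of the summand of `R` indexed by `p = (g, f)`: the cell with right edge
`f` and top edge `η(g)`. -/
def Rotation.cellY (η : Rotation M) (p : CompPair V) : Cell M :=
  ⟨η.map p.1.1, p.1.2, η.map_tgt_eq p.2⟩

theorem Rotation.cellX_eq_vinv (ξ : Rotation M) (p : CompPair V) : ξ.cellX p =
    (⟨(ξ.map p.1.2).inv, p.1.1.inv, ξ.inv_tgt_eq p.2⟩ : Cell M).vinv := by
  ext1
  · rfl
  · exact (Arr.inv_inv _).symm

theorem Rotation.bot_cellX (ξ : Rotation M) (p : CompPair V) :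
    (ξ.cellX p).bot = (ξ.map p.1.2).inv := by
  rw [ξ.cellX_eq_vinv, Cell.bot_vinv]

namespace IsMatchedRotations

variable {ξ η : Rotation M} (hξη : IsMatchedRotations ξ η)

include hξη in
/-- The matching condition on `(ξ, η)` in terms of cells. -/
theorem exists_comp_eq (p : CompPair V) :
    ∃ h : (η.cellY p).left.tgt = (ξ.cellX p).left.src,
      (η.cellY p).left.comp (ξ.cellX p).left h = p.prod := by
  obtain ⟨h, e⟩ := hξη p.1.2 p.1.1 p.2
  have hX : (ξ.cellX p).left = (M.left (ξ.map p.1.2).inv p.1.1.inv (ξ.inv_tgt_eq p.2)).inv := by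
    rw [ξ.cellX_eq_vinv, Cell.left_vinv]
    rfl
  rw [hX]
  exact ⟨h, e⟩

/-- The braiding of composable pairs: `(g, f)` goes to the pair `(f', g')` of the left edges of
`cellY` and `cellX`; it has the same product `f' g' = g f`. -/
def braid (p : CompPair V) : CompPair V :=
  ⟨((η.cellY p).left, (ξ.cellX p).left), (hξη.exists_comp_eq p).1⟩

theorem prod_braid (p : CompPair V) : (hξη.braid p).prod = p.prod := (hξη.exists_comp_eq p).2

/-- If `(g, f)` is braided to `(f', g')`, then `η(g) ◁ f = η(g')`. -/
theorem bot_cellY (p : CompPair V) : (η.cellY p).bot = η.map (hξη.braid p).1.2 := by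
  have h := (η.cellY p).rotate η
  have e : (η.map p.1.1).comp (η.map p.1.2) _ = (η.map (hξη.braid p).1.1).comp _ _ :=
    (η.map_comp _ _ p.2).symm.trans
      ((congrArg η.map (hξη.prod_braid p).symm).trans (η.map_comp _ _ (hξη.braid p).2))
  exact Arr.comp_left_cancel (h.symm.trans e)

/-- If `(g, f)` is braided to `(f', g')`, then the top edge of `cellX` is `ξ(f')⁻¹`. -/
theorem hor_cellX (p : CompPair V) : (ξ.cellX p).hor = (ξ.map (hξη.braid p).1.1).inv := by
  have h := (ξ.cellX p).rotate ξ
  have e : (ξ.map p.1.1).comp (ξ.map p.1.2) _ =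
      (ξ.map (hξη.braid p).1.1).comp (ξ.map (hξη.braid p).1.2) _ :=
    (ξ.map_comp _ _ p.2).symm.trans
      ((congrArg ξ.map (hξη.prod_braid p).symm).trans (ξ.map_comp _ _ (hξη.braid p).2))
  have e' := Arr.comp_inv_eq_inv_comp e
    ((congrArg Arr.tgt e).symm : (ξ.map (hξη.braid p).1.2).tgt = (ξ.map p.1.2).tgt)
    ((congrArg Arr.src e).symm : (ξ.map (hξη.braid p).1.1).src = (ξ.map p.1.1).src)
  refine Arr.comp_right_cancel (h.trans (Eq.trans ?_ e'))
  exact Arr.comp_congr rfl (ξ.bot_cellX p) _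

/-- The pair `(f', g')` determines the top edge `ξ(f')⁻¹` and the left edge `g'` of `cellX`, hence its
right edge `g`, and then `f` from `g f = f' g'`. -/
theorem braid_injective : Function.Injective hξη.braid := fun p q h => by
  have hX : ξ.cellX p = ξ.cellX q := by
    refine Cell.ext_left (congrArg (fun r : CompPair V => r.1.2) h) ?_
    rw [hξη.hor_cellX, hξη.hor_cellX, h]
  refine CompPair.ext_fst ?_ (congrArg Cell.ver hX)
  rw [← hξη.prod_braid p, h, hξη.prod_braid]

/-- The braiding as a permutation of the composable pairs. -/
noncomputable def braidEquiv [Finite (Arr V)] : CompPair V ≃ CompPair V :=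
  Equiv.ofBijective hξη.braid (Finite.injective_iff_bijective.1 hξη.braid_injective)

/-- The braiding as a permutation of the factorizations of an arrow. -/
noncomputable def braidSplitEquiv [Finite (Arr V)] (g : Arr V) :
    {p : CompPair V // p.prod = g} ≃ {p : CompPair V // p.prod = g} :=
  hξη.braidEquiv.subtypeEquiv fun p => by
    change p.prod = g ↔ (hξη.braid p).prod = g
    rw [hξη.prod_braid]

/-- Naturality of the braiding, for the second tensor factors. -/
theorem upper_hcomp_cellY (A : Cell M) (p : CompPair V) (hp : p.prod = A.ver) :
    (A.upper (hξη.braid p) ((hξη.prod_braid p).trans hp)).hcomp (η.cellY p) rfl =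
      (η.cellY (A.leftPair p hp)).hcomp (A.lower p hp) rfl := by
  ext1
  · exact (A.upper p hp).rotate η
  · rfl

/-- Naturality of the braiding, for the first tensor factors. -/
theorem lower_hcomp_cellX (A : Cell M) (p : CompPair V) (hp : p.prod = A.ver) :
    (A.lower (hξη.braid p) ((hξη.prod_braid p).trans hp)).hcomp (ξ.cellX p) rfl =
      (ξ.cellX (A.leftPair p hp)).hcomp (A.upper p hp) rfl := by
  -- Left edges of `upper_hcomp_cellY`: the braiding commutes with `leftPair`.
  have hl : (A.upper (hξη.braid p) ((hξη.prod_braid p).trans hp)).left =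
      (hξη.braid (A.leftPair p hp)).1.1 :=
    ((Cell.left_hcomp _ _ _).symm.trans
      (congrArg Cell.left (hξη.upper_hcomp_cellY A p hp))).trans (Cell.left_hcomp _ _ _)
  have h := (A.upper (hξη.braid p) ((hξη.prod_braid p).trans hp)).rotate ξ
  have e := Arr.comp_inv_eq_inv_comp h (congrArg Arr.tgt h).symm (congrArg Arr.src h).symm
  ext1
  · refine (Arr.comp_congr rfl (hξη.hor_cellX p) _).trans (e.trans ?_)
    refine Arr.comp_congr ?_ rfl _
    rw [hl, hξη.hor_cellX]
  · rfl

/-- For `p = (g, f)` and `f = f₁ f₂`: the pair `(g, f₁)`. -/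
def splitSndLeft (p s : CompPair V) (hs : s.prod = p.1.2) : CompPair V :=
  ⟨(p.1.1, s.1.1), p.2.trans (congrArg Arr.src hs).symm⟩

/-- For `p = (g, f)` and `f = f₁ f₂`: the pair `(g', f₂)`, where `g'` is the second component of the
braiding of `(g, f₁)`. -/
def splitSndRight (p s : CompPair V) (hs : s.prod = p.1.2) : CompPair V :=
  ⟨((hξη.braid (splitSndLeft p s hs)).1.2, s.1.2),
    (congrArg Arr.tgt (hξη.prod_braid (splitSndLeft p s hs))).trans s.2⟩

/-- For `p = (g, f)` and `g = g₁ g₂`: the pair `(g₂, f)`. -/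
def splitFstRight (p s : CompPair V) (hs : s.prod = p.1.1) : CompPair V :=
  ⟨(s.1.2, p.1.2), (congrArg Arr.tgt hs).trans p.2⟩

/-- For `p = (g, f)` and `g = g₁ g₂`: the pair `(g₁, f')`, where `f'` is the first component of the
braiding of `(g₂, f)`. -/
def splitFstLeft (p s : CompPair V) (hs : s.prod = p.1.1) : CompPair V :=
  ⟨(s.1.1, (hξη.braid (splitFstRight p s hs)).1.1),
    s.2.trans (congrArg Arr.src (hξη.prod_braid (splitFstRight p s hs))).symm⟩

theorem cellX_hcomp_cellX (p s : CompPair V) (hs : s.prod = p.1.2) :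
    (ξ.cellX (hξη.splitSndRight p s hs)).hcomp (ξ.cellX (splitSndLeft p s hs)) rfl =
      ξ.cellX p := by
  refine Cell.ext_bot rfl ?_
  refine (Cell.bot_hcomp _ _ _).trans
    ((Arr.comp_congr (ξ.bot_cellX _) (ξ.bot_cellX _) _).trans (Eq.trans ?_
      ((congrArg (fun f => (ξ.map f).inv) hs).trans (ξ.bot_cellX p).symm)))
  exact (Arr.comp_inv_rev _ _ _).symm.trans (congrArg Arr.inv (ξ.map_comp _ _ s.2).symm)

theorem upper_cellY (p s : CompPair V) (hs : s.prod = p.1.2) :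
    (η.cellY p).upper s hs = η.cellY (splitSndLeft p s hs) := rfl

theorem lower_cellY (p s : CompPair V) (hs : s.prod = p.1.2) :
    (η.cellY p).lower s hs = η.cellY (hξη.splitSndRight p s hs) := by
  ext1
  · exact hξη.bot_cellY (splitSndLeft p s hs)
  · rfl

theorem cellY_hcomp_cellY (p s : CompPair V) (hs : s.prod = p.1.1) :
    (η.cellY (hξη.splitFstLeft p s hs)).hcomp (η.cellY (splitFstRight p s hs)) rfl =
      η.cellY p := by
  ext1
  · exact (η.map_comp _ _ s.2).symm.trans (congrArg η.map hs)
  · rfl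

theorem lower_cellX (p s : CompPair V) (hs : s.prod = p.1.1) :
    (ξ.cellX p).lower s hs = ξ.cellX (splitFstRight p s hs) := by
  refine Cell.ext_bot rfl ?_
  exact (Cell.bot_lower _ _ _).trans
    ((ξ.bot_cellX p).trans (ξ.bot_cellX (splitFstRight p s hs)).symm)

theorem upper_cellX (p s : CompPair V) (hs : s.prod = p.1.1) :
    (ξ.cellX p).upper s hs = ξ.cellX (hξη.splitFstLeft p s hs) := by
  refine Cell.ext_bot rfl ?_
  rw [ξ.bot_cellX]
  exact (congrArg Cell.hor (lower_cellX p s hs)).trans (hξη.hor_cellX _)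

end IsMatchedRotations

end Braiding

/-! ### The quasitriangular structure -/

namespace CellAlg

variable {k : Type*} [Field k] {P : Type u} {V : Groupoid.{v} P} {H : Groupoid.{w} P}
  {M : MatchedPair V H} [Fintype (Arr V)]

open scoped Classical

theorem rMatrix_eq_sum (ξ η : Rotation M) :
    rMatrix k ξ η = ∑ p : CompPair V, of k (ξ.cellX p) ⊗ₜ[k] of k (η.cellY p) := by
  rw [rMatrix, Finset.sum_comm, ← Fintype.sum_prod_type']
  symm
  refine Fintype.sum_of_injective Subtype.val Subtype.val_injective _ _ ?_ ?_
  · intro q hq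
    exact dif_neg fun h => hq ⟨⟨q, h⟩, rfl⟩
  · intro p
    rw [dif_pos p.2]
    rfl

variable [Fintype (Arr H)]

theorem comulOp_one_eq_sum : comulOp k (1 : CellAlg k M) =
    ∑ p : CompPair V, of k (Cell.idH M p.1.2) ⊗ₜ[k] of k (Cell.idH M p.1.1) := by
  simp only [comulOp, LinearMap.comp_apply, comul_one_eq_sum, map_sum, LinearEquiv.coe_coe,
    TensorProduct.comm_tmul]

theorem tmul_mul_comul_one {A B : Cell M} (h : A.ver.tgt = B.ver.src) :
    (of k A ⊗ₜ[k] of k B) * Coalgebra.comul (R := k) (1 : CellAlg k M) = of k A ⊗ₜ[k] of k B := by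
  simp only [comul_one_eq_sum, Finset.mul_sum, Algebra.TensorProduct.tmul_mul_tmul, of_mul_idH]
  rw [Finset.sum_eq_single ⟨(A.ver, B.ver), h⟩, if_pos rfl, if_pos rfl]
  · intro p _ hp
    split_ifs with h1 h2
    · exact absurd (Subtype.ext (Prod.ext h1 h2)) hp
    all_goals simp
  · intro h
    exact absurd (Finset.mem_univ _) h

theorem comul_one_mul_tmul {A B : Cell M} (h : A.left.tgt = B.left.src) :
    Coalgebra.comul (R := k) (1 : CellAlg k M) * (of k A ⊗ₜ[k] of k B) = of k A ⊗ₜ[k] of k B := by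
  simp only [comul_one_eq_sum, Finset.sum_mul, Algebra.TensorProduct.tmul_mul_tmul, idH_mul_of]
  rw [Finset.sum_eq_single ⟨(A.left, B.left), h⟩, if_pos rfl, if_pos rfl]
  · intro p _ hp
    split_ifs with h1 h2
    · exact absurd (Subtype.ext (Prod.ext h1 h2)) hp
    all_goals simp
  · intro h
    exact absurd (Finset.mem_univ _) h

theorem tmul_mul_comulOp_one {A B : Cell M} (h : B.ver.tgt = A.ver.src) :
    (of k A ⊗ₜ[k] of k B) * comulOp k (1 : CellAlg k M) = of k A ⊗ₜ[k] of k B := by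
  simp only [comulOp_one_eq_sum, Finset.mul_sum, Algebra.TensorProduct.tmul_mul_tmul, of_mul_idH]
  rw [Finset.sum_eq_single ⟨(B.ver, A.ver), h⟩, if_pos rfl, if_pos rfl]
  · intro p _ hp
    split_ifs with h1 h2
    · exact absurd (Subtype.ext (Prod.ext h2 h1)) hp
    all_goals simp
  · intro h
    exact absurd (Finset.mem_univ _) h

theorem comulOp_one_mul_tmul {A B : Cell M} (h : B.left.tgt = A.left.src) :
    comulOp k (1 : CellAlg k M) * (of k A ⊗ₜ[k] of k B) = of k A ⊗ₜ[k] of k B := by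
  simp only [comulOp_one_eq_sum, Finset.sum_mul, Algebra.TensorProduct.tmul_mul_tmul, idH_mul_of]
  rw [Finset.sum_eq_single ⟨(B.left, A.left), h⟩, if_pos rfl, if_pos rfl]
  · intro p _ hp
    split_ifs with h1 h2
    · exact absurd (Subtype.ext (Prod.ext h2 h1)) hp
    all_goals simp
  · intro h
    exact absurd (Finset.mem_univ _) h

variable {ξ η : Rotation M} (hξη : IsMatchedRotations ξ η)

include hξη

/-- `R` lies in `Δᶜᵒᵖ(1) (H ⊗ H) Δ(1)`, since right edges of its summands form the composable pair
`(g, f)` and left edges the composable pair `(f', g')`. -/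
theorem rMatrix_eq_mul : rMatrix k ξ η =
    comulOp k (1 : CellAlg k M) * rMatrix k ξ η * Coalgebra.comul (R := k) (1 : CellAlg k M) := by
  rw [rMatrix_eq_sum, Finset.mul_sum, Finset.sum_mul]
  refine Finset.sum_congr rfl fun p _ => ?_
  rw [comulOp_one_mul_tmul (hξη.braid p).2, tmul_mul_comul_one p.2]

/-- Both sides are sums over the factorizations of the right edge of `A`, and the summands agree by
naturality of the braiding. -/
theorem comulOp_mul_rMatrix_of (A : Cell M) : comulOp k (of k A) * rMatrix k ξ η =
    rMatrix k ξ η * Coalgebra.comul (R := k) (of k A) := by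
  simp only [comulOp, LinearMap.comp_apply, comul_of_eq_sum, map_sum, LinearEquiv.coe_coe,
    TensorProduct.comm_tmul, rMatrix_eq_sum, Finset.sum_mul_sum,
    Algebra.TensorProduct.tmul_mul_tmul]
  rw [← (hξη.braidSplitEquiv A.ver).sum_comp,
    Finset.sum_comm (s := (Finset.univ : Finset (CompPair V)))]
  refine Finset.sum_congr rfl fun t _ => ?_
  rw [Finset.sum_eq_single t.1, Finset.sum_eq_single (A.leftPair t.1 t.2)]
  · rw [of_mul_of_pos (A := ξ.cellX _) (B := A.upper t.1 t.2) rfl,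
      of_mul_of_pos (A := η.cellY _) (B := A.lower t.1 t.2) rfl,
      ← hξη.lower_hcomp_cellX, ← hξη.upper_hcomp_cellY]
    exact congrArg₂ _ (of_mul_of_pos _) (of_mul_of_pos _)
  · intro p _ hp
    by_cases h1 : p.1.1 = (A.leftPair t.1 t.2).1.1
    · rw [of_mul_of_neg (A := η.cellY p), tmul_zero]
      exact fun h2 => hp (Subtype.ext (Prod.ext h1 h2))
    · rw [of_mul_of_neg (A := ξ.cellX p) h1, zero_tmul]
  · intro h
    exact absurd (Finset.mem_univ _) h
  · intro p _ hp
    by_cases h1 : (hξη.braid t.1).1.1 = (hξη.braid p).1.1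
    · rw [of_mul_of_neg (B := ξ.cellX p), zero_tmul]
      exact fun h2 => hp (hξη.braid_injective (Subtype.ext (Prod.ext h1 h2))).symm
    · rw [of_mul_of_neg (B := η.cellY p) h1, tmul_zero]
  · intro h
    exact absurd (Finset.mem_univ _) h

theorem comulOp_mul_rMatrix (a : CellAlg k M) : comulOp k a * rMatrix k ξ η =
    rMatrix k ξ η * Coalgebra.comul (R := k) a := by
  induction a using induction with
  | hof A => exact comulOp_mul_rMatrix_of hξη A
  | hadd a b ha hb => rw [map_add, map_add, add_mul, mul_add, ha, hb]
  | hsmul c a ha => rw [map_smul, map_smul, smul_mul_assoc, mul_smul_comm, ha]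
  | hz => rw [map_zero, map_zero, zero_mul, mul_zero]

/-- Both sides are sums over triples `(g, f₁, f₂)` of composable arrows. -/
theorem lTensor_comul_rMatrix :
    (Coalgebra.comul (R := k)).lTensor (CellAlg k M) (rMatrix k ξ η) =
      leg13 k (rMatrix k ξ η) * leg12 k (rMatrix k ξ η) := by
  simp only [leg13, leg12, rMatrix_eq_sum, map_sum, sum_tmul, LinearMap.lTensor_tmul,
    comul_of_eq_sum, tmul_sum, TensorProduct.assoc_tmul, TensorProduct.mk_apply, sum_mul_sum,
    Algebra.TensorProduct.tmul_mul_tmul, one_mul, mul_one]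
  refine (Fintype.sum_sigma' _).symm.trans (Eq.trans ?_ (Fintype.sum_prod_type' _))
  refine Fintype.sum_of_injective (fun x : (Σ p : CompPair V, {s : CompPair V // s.prod = p.1.2}) =>
    (hξη.splitSndRight x.1 x.2.1 x.2.2,
      IsMatchedRotations.splitSndLeft x.1 x.2.1 x.2.2))
    ?_ _ _ ?_ ?_
  · rintro ⟨⟨⟨g, f⟩, hp⟩, s, hs⟩ ⟨⟨⟨g', f'⟩, hp'⟩, s', hs'⟩ h
    obtain rfl : s.prod = f := hs
    obtain rfl : s'.prod = f' := hs'
    obtain rfl : g = g' := congrArg (fun r => r.2.1.1) h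
    obtain rfl : s = s' := Subtype.ext (Prod.ext (congrArg (fun r => r.2.1.2) h)
      (congrArg (fun r => r.1.1.2) h))
    rfl
  · rintro ⟨a, b⟩ h
    rw [of_mul_of_neg, zero_tmul]
    intro e
    have hs : b.1.2.tgt = a.1.2.src :=
      (congrArg Arr.tgt (hξη.prod_braid b)).symm.trans ((congrArg Arr.tgt e).symm.trans a.2)
    refine h ⟨⟨⟨(b.1.1, b.1.2.comp a.1.2 hs), b.2⟩, ⟨(b.1.2, a.1.2), hs⟩, rfl⟩, ?_⟩
    exact Prod.ext (Subtype.ext (Prod.ext e.symm rfl)) rfl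
  · rintro ⟨p, s, hs⟩
    rw [of_mul_of_pos rfl, hξη.cellX_hcomp_cellX p s hs, IsMatchedRotations.upper_cellY p s hs,
      hξη.lower_cellY p s hs]

/-- Both sides are sums over triples `(g₁, g₂, f)` of composable arrows. -/
theorem rTensor_comul_rMatrix :
    TensorProduct.assoc k _ _ _
      ((Coalgebra.comul (R := k)).rTensor (CellAlg k M) (rMatrix k ξ η)) =
      leg13 k (rMatrix k ξ η) * leg23 k (rMatrix k ξ η) := by
  simp only [leg13, leg23, rMatrix_eq_sum, map_sum, sum_tmul, LinearMap.lTensor_tmul,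
    LinearMap.rTensor_tmul,
    comul_of_eq_sum, tmul_sum, TensorProduct.assoc_tmul, TensorProduct.mk_apply, sum_mul_sum,
    Algebra.TensorProduct.tmul_mul_tmul, one_mul, mul_one]
  refine (Fintype.sum_sigma' _).symm.trans (Eq.trans ?_ (Fintype.sum_prod_type' _))
  refine Fintype.sum_of_injective (fun x : (Σ p : CompPair V, {s : CompPair V // s.prod = p.1.1}) =>
    (hξη.splitFstLeft x.1 x.2.1 x.2.2,
      IsMatchedRotations.splitFstRight x.1 x.2.1 x.2.2))
    ?_ _ _ ?_ ?_
  · rintro ⟨⟨⟨g, f⟩, hp⟩, s, hs⟩ ⟨⟨⟨g', f'⟩, hp'⟩, s', hs'⟩ h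
    obtain rfl : s.prod = g := hs
    obtain rfl : s'.prod = g' := hs'
    obtain rfl : f = f' := congrArg (fun r => r.2.1.2) h
    obtain rfl : s = s' := Subtype.ext (Prod.ext (congrArg (fun r => r.1.1.1) h)
      (congrArg (fun r => r.2.1.1) h))
    rfl
  · rintro ⟨a, b⟩ h
    rw [of_mul_of_neg, tmul_zero, tmul_zero]
    intro e
    have e' : (hξη.braid b).prod.src = b.prod.src := congrArg Arr.src (hξη.prod_braid b)
    have hs : a.1.1.tgt = b.1.1.src := (a.2.trans (congrArg Arr.src e)).trans e'
    refine h ⟨⟨⟨(a.1.1.comp b.1.1 hs, b.1.2), b.2⟩, ⟨(a.1.1, b.1.1), hs⟩, rfl⟩, ?_⟩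
    exact Prod.ext (Subtype.ext (Prod.ext rfl e.symm)) rfl
  · rintro ⟨p, s, hs⟩
    rw [of_mul_of_pos rfl, hξη.cellY_hcomp_cellY p s hs, hξη.upper_cellX p s hs,
      IsMatchedRotations.lower_cellX p s hs]

/-- The inverse of `R` is the sum of the horizontal inverses of its summands; no mixed terms survive,
because the braiding is a bijection. -/
theorem exists_inv_rMatrix : ∃ R' : CellAlg k M ⊗[k] CellAlg k M,
    (∃ T : CellAlg k M ⊗[k] CellAlg k M,
      R' = Coalgebra.comul (R := k) (1 : CellAlg k M) * T * comulOp k (1 : CellAlg k M)) ∧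
      rMatrix k ξ η * R' = comulOp k (1 : CellAlg k M) ∧
      R' * rMatrix k ξ η = Coalgebra.comul (R := k) (1 : CellAlg k M) := by
  refine ⟨∑ p : CompPair V, of k (ξ.cellX p).hinv ⊗ₜ[k] of k (η.cellY p).hinv,
    ⟨∑ p : CompPair V, of k (ξ.cellX p).hinv ⊗ₜ[k] of k (η.cellY p).hinv, ?_⟩, ?_, ?_⟩
  · rw [Finset.mul_sum, Finset.sum_mul]
    refine Finset.sum_congr rfl fun p _ => ?_
    rw [comul_one_mul_tmul, tmul_mul_comulOp_one (hξη.braid p).2]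
    rw [Cell.left_hinv, Cell.left_hinv]
    exact p.2
  · rw [rMatrix_eq_sum, Finset.sum_mul_sum, comulOp_one_eq_sum]
    refine Eq.trans (Finset.sum_congr rfl fun p _ => ?_) (hξη.braidEquiv.sum_comp fun p =>
      of k (Cell.idH M p.1.2) ⊗ₜ[k] of k (Cell.idH M p.1.1))
    simp only [Algebra.TensorProduct.tmul_mul_tmul]
    rw [Finset.sum_eq_single p, of_mul_of_pos (Cell.left_hinv _).symm,
      of_mul_of_pos (Cell.left_hinv _).symm, Cell.hcomp_hinv, Cell.hcomp_hinv]
    · rfl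
    · intro q _ hq
      by_cases h1 : p.1.1 = q.1.1
      · rw [of_mul_of_neg (A := η.cellY p), tmul_zero]
        rw [Cell.left_hinv]
        exact fun h2 => hq (Subtype.ext (Prod.ext h1 h2)).symm
      · rw [of_mul_of_neg (A := ξ.cellX p), zero_tmul]
        rw [Cell.left_hinv]
        exact h1
    · intro h
      exact absurd (Finset.mem_univ _) h
  · rw [rMatrix_eq_sum, Finset.sum_mul_sum, comul_one_eq_sum]
    refine Finset.sum_congr rfl fun p _ => ?_
    simp only [Algebra.TensorProduct.tmul_mul_tmul]
    rw [Finset.sum_eq_single p, of_mul_of_pos rfl, of_mul_of_pos rfl, Cell.hinv_hcomp,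
      Cell.hinv_hcomp]
    · rfl
    · intro q _ hq
      by_cases h1 : (hξη.braid p).1.1 = (hξη.braid q).1.1
      · rw [of_mul_of_neg (B := ξ.cellX q), zero_tmul]
        exact fun h2 => hq (hξη.braid_injective (Subtype.ext (Prod.ext h1 h2))).symm
      · rw [of_mul_of_neg (B := η.cellY q) h1, tmul_zero]
    · intro h
      exact absurd (Finset.mem_univ _) h

end CellAlg

end MatchedGpd
open MatchedGpd in
/-- A matched pair of rotations `(ξ, η)` for a matched pair `(V, H)` of finite groupoids makes
`k(V, H)`, with the antipode that inverts cells, a quasitriangular weak Hopf algebra. -/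
theorem theorem4 {k : Type*} [Field k] {P : Type*}
    (V : CategoryTheory.Groupoid P) (H : CategoryTheory.Groupoid P)
    [Fintype (Arr V)] [Fintype (Arr H)] (M : MatchedPair V H)
    (ξ η : Rotation M) (hξη : IsMatchedRotations ξ η) :
    IsAntipode k (CellAlg.antipode k (M := M)) ∧ IsQuasitriangular k (CellAlg.rMatrix k ξ η) :=
  ⟨CellAlg.isAntipode k M, {
    toIsWeakBialgebra := CellAlg.isWeakBialgebra k M
    exists_antipode := ⟨_, CellAlg.isAntipode k M⟩
    mem := ⟨_, CellAlg.rMatrix_eq_mul hξη⟩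
    comulOp_mul := CellAlg.comulOp_mul_rMatrix hξη
    id_comul := CellAlg.lTensor_comul_rMatrix hξη
    comul_id := CellAlg.rTensor_comul_rMatrix hξη
    exists_inv := CellAlg.exists_inv_rMatrix hξη }⟩
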